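/- **Definitions.** A monotone CNF $\varphi$ over the variables $x_1,\dots,x_n$ is a set of clauses, each clause a set of variables; $\|\varphi\|$ is the total number of literal occurrences in $\varphi$. It is *prime* if each of its clauses is a prime implicate of the monotone Boolean function $f$ represented by $\varphi$. *GYO operations*: (1) if a variable $x$ occurs in exactly one clause $c$, remove $x$ from $c$; (2) if distinct clauses $c,c'$ satisfy $c\subseteq c'$, remove $c$. A *GYO-reduction* of $\varphi$ is a sequence of such operations that leads from $\varphi$ to the CNF $0$ whose only clause is the empty clause. $\varphi$ is *$\alpha$-acyclic* if $\varphi=1$ (no clauses) or $\varphi$ has a GYO-reduction. For an ordering $b_1,\dots,b_n$ of the variables let $\varphi_i$ be the CNF of all clauses of $\varphi$ that contain only variables among $b_1,\dots,b_i$, and let $\Delta^i=\varphi_i\setminus\varphi_{i-1}$; $\varphi$ is *$k$-degenerate* if there is an ordering with $|\Delta^i|\le k$ for all $i=1,\dots,n$. *Dualization* is the problem of listing, given $\varphi$ (with clauses, and variables in clauses, in any order), the clauses of the prime CNF of the dual function $f^d(x)=\neg f(\neg x)$, each exactly once; as sets of variables these are the prime implicants of $f$. The *delay* is the maximal time until the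 first item is output, between two consecutive items, and from the last item (or the start, if there is none) until the algorithm halts, measured in unit-cost steps of a random access machine whose only arithmetic operations are successor and predecessor (with base-plus-offset memory addressing). **Theorem.** 1. There are one program and one constant $C$ such that for all $n\ge 0$ and all $\alpha$-acyclic prime monotone CNFs $\varphi$ over $n$ variables, the program solves Dualization for $\varphi$ with delay at most $C\cdot(\|\varphi\|\cdot n^2+1)$; that is, with $O(\|\varphi\|\cdot n^2)$ delay, where the summand $1$ matters only for the constant CNFs ($\|\varphi\|\cdot n^2=0$). 2. Every $\alpha$-acyclic prime monotone CNF is $1$-degenerate. 3. More precisely, let $\varphi$ be a prime monotone CNF with a GYO-reduction $a$. There is an ordering of the variables that is the reverse of the order in which $a$ removes variables (if $a$ removes $x$ before $y$, then $y$ precedes $x$ in the ordering), and every such ordering satisfies $|\Delta^i|\le 1$ for all $i$. -/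

import Mathlib

namespace MonotoneDual

/-! ### Boolean functions, clauses, terms, prime monotone CNFs -/

/-- Boolean functions of the variables `x_0, …, x_{n-1}`, ordered pointwise with `false < true`. -/
abbrev BoolFun (n : ℕ) : Type := (Fin n → Bool) → Bool

/-- The literal `(x, true)` is the variable `x`, and `(x, false)` is its complement. -/
abbrev Literal (n : ℕ) : Type := Fin n × Bool

/-- Clauses and terms are sets of literals with at most one literal for each variable. -/
def IsConsistent {n : ℕ} (t : Finset (Literal n)) : Prop :=
  ∀ x : Fin n, ¬ ((x, true) ∈ t ∧ (x, false) ∈ t)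

/-- The conjunction of the literals in `t`. -/
def termFun {n : ℕ} (t : Finset (Literal n)) : BoolFun n :=
  fun v => decide (∀ l ∈ t, v l.1 = l.2)

/-- The disjunction of the literals in `c`. -/
def clauseFun {n : ℕ} (c : Finset (Literal n)) : BoolFun n :=
  fun v => decide (∃ l ∈ c, v l.1 = l.2)

/-- `t` is a prime implicant of `f`: a term `t ≤ f` such that no term `t' > t` satisfies
`t' ≤ f`. -/
def IsPrimeImplicant {n : ℕ} (f : BoolFun n) (t : Finset (Literal n)) : Prop :=
  IsConsistent t ∧ termFun t ≤ f ∧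
    ¬ ∃ t' : Finset (Literal n), IsConsistent t' ∧ termFun t' ≤ f ∧ termFun t < termFun t'

/-- `c` is a prime implicate of `f`: a clause `c ≥ f` such that no clause `c' < c` satisfies
`c' ≥ f`. -/
def IsPrimeImplicate {n : ℕ} (f : BoolFun n) (c : Finset (Literal n)) : Prop :=
  IsConsistent c ∧ f ≤ clauseFun c ∧
    ¬ ∃ c' : Finset (Literal n), IsConsistent c' ∧ f ≤ clauseFun c' ∧ clauseFun c' < clauseFun c

/-- The dual function `f^d(x) = ¬ f(¬ x)`. -/
def dual {n : ℕ} (f : BoolFun n) : BoolFun n :=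
  fun v => !(f fun x => !(v x))

/-- The set of positive literals of the variables in `s`. -/
def positive {n : ℕ} (s : Finset (Fin n)) : Finset (Literal n) :=
  s.image fun x => (x, true)

/-- A monotone CNF, as a set of clauses; a monotone clause is given by its set of variables. -/
abbrev CNF (n : ℕ) : Type := Finset (Finset (Fin n))

/-- The monotone Boolean function represented by `φ`. -/
def CNF.fn {n : ℕ} (φ : CNF n) : BoolFun n :=
  fun v => decide (∀ c ∈ φ, clauseFun (positive c) v = true)

/-- All clauses of `φ` are prime implicates of the function that `φ` represents. -/
def CNF.IsPrime {n : ℕ} (φ : CNF n) : Prop :=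
  ∀ c ∈ φ, IsPrimeImplicate φ.fn (positive c)

/-- The length `‖φ‖`: the number of literal occurrences in `φ`. -/
def CNF.length {n : ℕ} (φ : CNF n) : ℕ := ∑ c ∈ φ, c.card

/-! ### GYO-reductions and `α`-acyclicity -/

/-- The operations in a GYO-reduction: removal of a variable from the only clause that contains
it, and removal of a clause. -/
inductive GYOOp (n : ℕ) : Type
  | var (x : Fin n) : GYOOp n
  | clause (c : Finset (Fin n)) : GYOOp n

/-- `GYO φ a ψ`: the sequence `a` of operations is a GYO-reduction of `φ` to `ψ`. -/
inductive GYO {n : ℕ} : CNF n → List (GYOOp n) → CNF n → Prop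
  | nil (φ : CNF n) : GYO φ [] φ
  | removeVar {φ ψ : CNF n} {a : List (GYOOp n)} (x : Fin n) (c : Finset (Fin n)) :
      c ∈ φ → x ∈ c → (∀ d ∈ φ, x ∈ d → d = c) →
      GYO (insert (c.erase x) (φ.erase c)) a ψ → GYO φ (GYOOp.var x :: a) ψ
  | removeClause {φ ψ : CNF n} {a : List (GYOOp n)} (c d : Finset (Fin n)) :
      c ∈ φ → d ∈ φ → c ≠ d → c ⊆ d →
      GYO (φ.erase c) a ψ → GYO φ (GYOOp.clause c :: a) ψ

/-- `φ` is `α`-acyclic: `φ = 1` (no clauses), or some GYO-reduction leads from `φ` to the CNF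
`0` whose only clause is the empty clause. -/
def CNF.AlphaAcyclic {n : ℕ} (φ : CNF n) : Prop :=
  φ = ∅ ∨ ∃ a : List (GYOOp n), GYO φ a {∅}

/-! ### Degenerate CNFs -/

/-- For the variable ordering `σ 0, σ 1, …, σ (n-1)`, the CNF obtained from `φ` by fixing to `1`
all variables but the first `i` ones. A clause that contains a fixed variable disappears, and the
other clauses are unchanged. -/
def CNF.initialPart {n : ℕ} (φ : CNF n) (σ : Equiv.Perm (Fin n)) (i : ℕ) : CNF n :=
  φ.filter fun c => ∀ x ∈ c, (σ.symm x : ℕ) < i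

/-- The clauses that appear when the variable `σ i` is released. -/
def CNF.delta {n : ℕ} (φ : CNF n) (σ : Equiv.Perm (Fin n)) (i : Fin n) : CNF n :=
  φ.initialPart σ (i + 1) \ φ.initialPart σ i

/-- The variable ordering `σ` witnesses that `φ` is `k`-degenerate. -/
def CNF.IsDegenerateVia {n : ℕ} (φ : CNF n) (k : ℕ) (σ : Equiv.Perm (Fin n)) : Prop :=
  ∀ i : Fin n, (φ.delta σ i).card ≤ k

/-- `φ` is `k`-degenerate. -/
def CNF.IsDegenerate {n : ℕ} (φ : CNF n) (k : ℕ) : Prop :=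
  ∃ σ : Equiv.Perm (Fin n), φ.IsDegenerateVia k σ

/-- The variable ordering `σ` is the reverse of the order in which `a` removes variables: if `a`
removes `x` before it removes `y`, then `y` precedes `x` in the ordering. -/
def ReversesRemovals {n : ℕ} (σ : Equiv.Perm (Fin n)) (a : List (GYOOp n)) : Prop :=
  ∀ x y : Fin n, [GYOOp.var x, GYOOp.var y].Sublist a → σ.symm y < σ.symm x

/-! ### Random access machines with output

A program works on finitely many registers and on a memory with random access, which both hold
natural numbers. Every assignment, output operation and test takes one unit of time. The only
arithmetic operations are the successor and the predecessor (memory is addressed as base plus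
offset), so that the largest number stored grows by at most one in a unit of time, apart from
the finitely many constants of the program. -/

/-- Programs. Registers are named by natural numbers. -/
inductive Prog : Type
  /-- `R[r] := k` -/
  | set (r k : ℕ) : Prog
  /-- `R[r] := R[s]` -/
  | copy (r s : ℕ) : Prog
  /-- `R[r] := R[r] + 1` -/
  | inc (r : ℕ) : Prog
  /-- `R[r] := R[r] - 1`, where `0 - 1 = 0` -/
  | dec (r : ℕ) : Prog
  /-- `R[r] := M[R[a] + R[i]]` -/
  | load (r a i : ℕ) : Prog
  /-- `M[R[a] + R[i]] := R[r]` -/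
  | store (a i r : ℕ) : Prog
  /-- write `R[r]` to the output -/
  | write (r : ℕ) : Prog
  /-- declare that the current item of the output is complete -/
  | endItem : Prog
  /-- `p; q` -/
  | seq (p q : Prog) : Prog
  /-- `if R[a] < R[b] then p else q` -/
  | ite (a b : ℕ) (p q : Prog) : Prog
  /-- `while R[a] < R[b] do p` -/
  | loop (a b : ℕ) (p : Prog) : Prog

/-- The contents of the registers and of the memory. -/
structure State : Type where
  reg : ℕ → ℕ
  mem : ℕ → ℕ

/-- What can be observed in one unit of time: nothing, an output of a number, or the completion
of an item of the output. -/
inductive Event : Type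
  | tick : Event
  | write (k : ℕ) : Event
  | endItem : Event

/-- `R[r] := k` -/
def State.setReg (s : State) (r k : ℕ) : State :=
  { s with reg := Function.update s.reg r k }

/-- `M[a] := k` -/
def State.setMem (s : State) (a k : ℕ) : State :=
  { s with mem := Function.update s.mem a k }

/-- `Runs p s tr s'`: started in the state `s`, the program `p` halts in the state `s'`, and `tr`
is the sequence of events of this run, one event for each unit of time. -/
inductive Runs : Prog → State → List Event → State → Prop
  | set (s : State) (r k : ℕ) : Runs (.set r k) s [.tick] (s.setReg r k)
  | copy (s : State) (r r' : ℕ) : Runs (.copy r r') s [.tick] (s.setReg r (s.reg r'))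
  | inc (s : State) (r : ℕ) : Runs (.inc r) s [.tick] (s.setReg r (s.reg r + 1))
  | dec (s : State) (r : ℕ) : Runs (.dec r) s [.tick] (s.setReg r (s.reg r - 1))
  | load (s : State) (r a i : ℕ) :
      Runs (.load r a i) s [.tick] (s.setReg r (s.mem (s.reg a + s.reg i)))
  | store (s : State) (a i r : ℕ) :
      Runs (.store a i r) s [.tick] (s.setMem (s.reg a + s.reg i) (s.reg r))
  | write (s : State) (r : ℕ) : Runs (.write r) s [.write (s.reg r)] s
  | endItem (s : State) : Runs .endItem s [.endItem] s
  | seq {p q : Prog} {s s' s'' : State} {u w : List Event} :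
      Runs p s u s' → Runs q s' w s'' → Runs (.seq p q) s (u ++ w) s''
  | iteTrue {a b : ℕ} {p q : Prog} {s s' : State} {u : List Event} :
      s.reg a < s.reg b → Runs p s u s' → Runs (.ite a b p q) s (.tick :: u) s'
  | iteFalse {a b : ℕ} {p q : Prog} {s s' : State} {u : List Event} :
      ¬ s.reg a < s.reg b → Runs q s u s' → Runs (.ite a b p q) s (.tick :: u) s'
  | loopTrue {a b : ℕ} {p : Prog} {s s' s'' : State} {u w : List Event} :
      s.reg a < s.reg b → Runs p s u s' → Runs (.loop a b p) s' w s'' →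
      Runs (.loop a b p) s (.tick :: (u ++ w)) s''
  | loopFalse {a b : ℕ} {p : Prog} {s : State} :
      ¬ s.reg a < s.reg b → Runs (.loop a b p) s [.tick] s

/-- The numbers that are written in a sequence of events. -/
def written : List Event → List ℕ
  | [] => []
  | .tick :: u => written u
  | .write k :: u => k :: written u
  | .endItem :: u => written u

/-- `OutputsWithDelay D tr ws`: the run with the events `tr` outputs the items `ws` one after the
other, such that at most `D` units of time pass until the first item is complete, between the
completion of an item and that of the next one, and from the completion of the last item (from
the start, if there is none) until the machine halts. -/
inductive OutputsWithDelay (D : ℕ) : List Event → List (List ℕ) → Prop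
  | halt (u : List Event) : Event.endItem ∉ u → written u = [] → u.length ≤ D →
      OutputsWithDelay D u []
  | item (u : List Event) {tr : List Event} {ws : List (List ℕ)} :
      Event.endItem ∉ u → u.length + 1 ≤ D → OutputsWithDelay D tr ws →
      OutputsWithDelay D (u ++ Event.endItem :: tr) (written u :: ws)

/-! ### Input, output, and dualization -/

/-- `I` lists the clauses of `φ`, and the variables of each clause, in some order and without
repetition. -/
def IsListing {n : ℕ} (I : List (List (Fin n))) (φ : CNF n) : Prop :=
  (∀ c ∈ I, c.Nodup) ∧ (I.map List.toFinset).Nodup ∧ (I.map List.toFinset).toFinset = φ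

/-- The input of the machine: the number of variables, the number of clauses, and for each clause
its number of variables followed by its variables. -/
def encode {n : ℕ} (I : List (List (Fin n))) : List ℕ :=
  n :: I.length :: I.flatMap fun c => c.length :: c.map fun x => (x : ℕ)

/-- The input is in the memory from address `0` on, and everything else is `0`. -/
def initialState {n : ℕ} (I : List (List (Fin n))) : State where
  reg := fun _ => 0
  mem := fun a => (encode I).getD a 0

/-- The list of numbers `w` represents the monotone clause (or term) `t`: it lists the variables of
`t` in some order and without repetition. -/
def Represents {n : ℕ} (w : List ℕ) (t : Finset (Literal n)) : Prop :=
  ∃ l : List (Fin n), l.Nodup ∧ (l.map fun x => (x : ℕ)) = w ∧ positive l.toFinset = t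

/-- On every input that lists the monotone CNF `φ` of a function `f`, the program `P` halts after
it has output, with delay at most `D`, the clauses of the prime CNF of the dual `f^d` (that is, all
prime implicates of `f^d`), each of them once. The same sets of variables are the terms of the
prime DNF of `f` (that is, all prime implicants of `f`). -/
def DualizesWithDelay (P : Prog) {n : ℕ} (φ : CNF n) (D : ℕ) : Prop :=
  ∀ I : List (List (Fin n)), IsListing I φ →
    ∃ (tr : List Event) (s : State) (ws : List (List ℕ)) (ts : List (Finset (Literal n))),
      Runs P (initialState I) tr s ∧ OutputsWithDelay D tr ws ∧
      List.Forall₂ Represents ws ts ∧ ts.Nodup ∧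
      (∀ t : Finset (Literal n), t ∈ ts ↔ IsPrimeImplicate (dual φ.fn) t) ∧
      (∀ t : Finset (Literal n), t ∈ ts ↔ IsPrimeImplicant φ.fn t)

end MonotoneDual

open MonotoneDual

/-!
During a GYO-reduction, as long as none of its variables has been removed, a subset of a clause
stays a subset of a clause. Let `x` be the last variable of two clauses `c` and `d` of `φ` in an
ordering that reverses the removals. Then `x` is the first variable of `c ∪ d` to be removed, at
which time a single clause contains `x`, so `c ∪ d` is contained in one clause of `φ`. The clauses
of a prime CNF form an antichain, whence `c = d`; so prime `α`-acyclic CNFs are `1`-degenerate.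

The prime implicants of `f` are the minimal transversals of the clauses. If `φ` is `1`-degenerate,
then in every set of nonempty clauses the last variable that occurs lies in one clause only. The
clauses can therefore be arranged as `c₀, c₁, …`, each with a variable that occurs in none of the
preceding ones. Every minimal transversal of `c₀, …, c_j` arises from exactly one minimal
transversal of `c₀, …, c_{j-1}` by adding nothing or one element of `c_j`, and every minimal
transversal of `c₀, …, c_{j-1}` extends in this way, if necessary by the new variable. So the
minimal transversals of the initial segments form a tree, without repetitions, all of whose
branches reach the last level. Between two of its leaves, a depth-first search ascends at most once
and descends at most once, trying at most `‖φ‖` elements and once per clause the option to add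
nothing, each with a test for minimality in time `O(n²)`, as there are at most `n` clauses.
-/

namespace MonotoneDual

/-! ### Prime implicants and minimal transversals -/

section PrimeImplicants

variable {n : ℕ} {f g : BoolFun n} {φ : CNF n} {c d s : Finset (Fin n)}
  {t u : Finset (Literal n)} {v : Fin n → Bool}

/-- `s` is a transversal of `φ`: it meets every clause. -/
def CNF.IsTransversal (φ : CNF n) (s : Finset (Fin n)) : Prop :=
  ∀ c ∈ φ, ∃ x ∈ c, x ∈ s

/-- The variables that occur positively in `t`. -/
def positivePart (t : Finset (Literal n)) : Finset (Fin n) :=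
  Finset.univ.filter fun x => (x, true) ∈ t

theorem BoolFun.le_iff : f ≤ g ↔ ∀ v, f v = true → g v = true :=
  Pi.le_def.trans (forall_congr' fun _ => Bool.le_iff_imp)

theorem mk_mem_positive {x : Fin n} {b : Bool} : (x, b) ∈ positive s ↔ x ∈ s ∧ b = true := by
  simp [positive, eq_comm]

theorem mem_positivePart {x : Fin n} : x ∈ positivePart t ↔ (x, true) ∈ t := by
  simp [positivePart]

theorem positive_subset_iff : positive s ⊆ t ↔ s ⊆ positivePart t := by
  simp [positive, Finset.subset_iff, mem_positivePart]

theorem positivePart_positive : positivePart (positive s) = s := by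
  ext x
  simp [mem_positivePart, mk_mem_positive]

theorem positive_injective : Function.Injective (positive (n := n)) :=
  Function.LeftInverse.injective fun _ => positivePart_positive

theorem isConsistent_positive (s : Finset (Fin n)) : IsConsistent (positive s) := by
  simp [IsConsistent, mk_mem_positive]

theorem IsConsistent.insert_not (ht : IsConsistent t) {x : Fin n} {b : Bool} (hx : (x, b) ∉ t) :
    IsConsistent (insert (x, !b) t) := by
  intro y hy
  have hty := ht y
  cases b <;> simp only [Finset.mem_insert, Prod.mk.injEq] at hy <;> grind

theorem termFun_eq_true : termFun t v = true ↔ ∀ l ∈ t, v l.1 = l.2 := by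
  simp [termFun]

theorem CNF.fn_eq_true : φ.fn v = true ↔ ∀ c ∈ φ, ∃ x ∈ c, v x = true := by
  simp [CNF.fn, clauseFun, positive]

theorem IsConsistent.termFun_mem (ht : IsConsistent t) :
    termFun t (fun x => decide ((x, true) ∈ t)) = true := by
  rw [termFun_eq_true]
  rintro ⟨x, b⟩ hx
  have hxt := ht x
  cases b <;> simp_all

theorem termFun_le_termFun_iff (ht : IsConsistent t) : termFun t ≤ termFun u ↔ u ⊆ t := by
  simp only [BoolFun.le_iff, termFun_eq_true]
  refine ⟨fun h => ?_, fun hut v hv l hl => hv l (hut hl)⟩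
  rintro ⟨x, b⟩ hxu
  by_contra hxt
  have hv := termFun_eq_true.1 (ht.insert_not hxt).termFun_mem
  have hvx := h (fun y => decide ((y, true) ∈ insert (x, !b) t))
    (fun l hl => hv l (Finset.mem_insert_of_mem hl)) (x, b) hxu
  have hvx' := hv (x, !b) (Finset.mem_insert_self _ _)
  exact (Bool.not_eq_self b).1 (hvx'.symm.trans hvx)

theorem termFun_le_fn_iff (ht : IsConsistent t) :
    termFun t ≤ φ.fn ↔ φ.IsTransversal (positivePart t) := by
  simp only [BoolFun.le_iff, CNF.fn_eq_true, CNF.IsTransversal, mem_positivePart]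
  refine ⟨fun h => by simpa using h _ ht.termFun_mem, fun h v hv c hc => ?_⟩
  exact (h c hc).imp fun x hx => ⟨hx.1, termFun_eq_true.1 hv _ hx.2⟩

theorem isPrimeImplicant_iff_minimal :
    IsPrimeImplicant f t ↔ Minimal (fun u => IsConsistent u ∧ termFun u ≤ f) t := by
  rw [minimal_iff_forall_lt, IsPrimeImplicant, and_assoc, not_exists]
  refine and_congr_right fun ht => and_congr_right fun _ => forall_congr' fun u => ?_
  have hlt (hu : IsConsistent u) : termFun t < termFun u ↔ u < t := by
    rw [lt_iff_le_not_ge, lt_iff_le_not_ge, termFun_le_termFun_iff ht, termFun_le_termFun_iff hu]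
  grind

theorem isPrimeImplicant_fn_iff :
    IsPrimeImplicant φ.fn t ↔ ∃ s, Minimal φ.IsTransversal s ∧ positive s = t := by
  have hfn : (fun u => IsConsistent u ∧ termFun u ≤ φ.fn) =
      fun u => IsConsistent u ∧ φ.IsTransversal (positivePart u) :=
    funext fun u => propext (and_congr_right termFun_le_fn_iff)
  have hpos {s} (hs : φ.IsTransversal s) :
      IsConsistent (positive s) ∧ φ.IsTransversal (positivePart (positive s)) :=
    ⟨isConsistent_positive s, positivePart_positive.symm ▸ hs⟩
  rw [isPrimeImplicant_iff_minimal, hfn]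
  constructor
  · intro ht
    have hle {s} (hs : φ.IsTransversal s) (hst : s ⊆ positivePart t) : t ⊆ positive s :=
      ht.le_of_le (hpos hs) (positive_subset_iff.2 hst)
    refine ⟨positivePart t, ⟨ht.prop.2, fun s hs hst x hx => ?_⟩,
      (positive_subset_iff.2 subset_rfl).antisymm (hle ht.prop.2 subset_rfl)⟩
    exact (mk_mem_positive.1 (hle hs hst (mem_positivePart.1 hx))).1
  · rintro ⟨s, hs, rfl⟩
    refine ⟨hpos hs.prop, fun u hu hus => positive_subset_iff.2 (hs.le_of_le hu.2 fun x hx => ?_)⟩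
    exact (mk_mem_positive.1 (hus (mem_positivePart.1 hx))).1

theorem dual_le_dual : dual f ≤ dual g ↔ g ≤ f := by
  rw [Pi.le_def, Pi.le_def, compl_surjective.forall (p := fun v => g v ≤ f v)]
  exact forall_congr' fun v => compl_le_compl_iff_le

theorem dual_termFun (t : Finset (Literal n)) : dual (termFun t) = clauseFun t := by
  funext v
  simp only [dual, termFun, clauseFun, ← decide_not, not_forall, exists_prop, Bool.not_not_eq]

theorem isPrimeImplicate_dual_iff : IsPrimeImplicate (dual f) t ↔ IsPrimeImplicant f t := by
  simp only [IsPrimeImplicate, IsPrimeImplicant, ← dual_termFun, dual_le_dual, lt_iff_le_not_ge]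

theorem CNF.IsPrime.isAntichain (hφ : φ.IsPrime) :
    IsAntichain (· ⊆ ·) (φ : Set (Finset (Fin n))) := by
  intro c hc d hd hne hcd
  refine (hφ d hd).2.2 ⟨positive c, isConsistent_positive c, (hφ c hc).2.1, ?_⟩
  rw [← dual_termFun, ← dual_termFun, lt_iff_le_not_ge, dual_le_dual, dual_le_dual,
    termFun_le_termFun_iff (isConsistent_positive d),
    termFun_le_termFun_iff (isConsistent_positive c), positive_subset_iff, positive_subset_iff,
    positivePart_positive, positivePart_positive]
  exact ⟨hcd, fun hdc => hne (hcd.antisymm hdc)⟩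

end PrimeImplicants

/-! ### GYO-reductions and degenerate orderings -/

section Degenerate

variable {n k : ℕ} {φ ψ : CNF n} {a : List (GYOOp n)} {σ : Equiv.Perm (Fin n)}
  {x y : Fin n} {c d e : Finset (Fin n)}

/-- The simplicial complex spanned by `φ`, that is, the subsets of clauses. Removing a clause that
is contained in another one does not change it, and removing a variable amounts to deleting a
vertex, so that it records all that matters about the course of a GYO-reduction. -/
def CNF.faces (φ : CNF n) : Set (Finset (Fin n)) :=
  {e | ∃ c ∈ φ, e ⊆ c}

/-- The variable that an operation removes, if any. -/
def GYOOp.removedVar : GYOOp n → Option (Fin n)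
  | .var x => some x
  | .clause _ => none

/-- The variables that `a` removes, in the order of their removal. -/
def removedVars (a : List (GYOOp n)) : List (Fin n) :=
  a.filterMap GYOOp.removedVar

theorem CNF.mem_faces_removeVar (hc : c ∈ φ) (hu : ∀ d ∈ φ, x ∈ d → d = c) :
    e ∈ CNF.faces (insert (c.erase x) (φ.erase c)) ↔ e ∈ φ.faces ∧ x ∉ e := by
  simp only [CNF.faces, Set.mem_ofPred_eq, Finset.exists_mem_insert, Finset.subset_erase,
    Finset.mem_erase]
  constructor
  · rintro (⟨hec, hx⟩ | ⟨d, ⟨hdc, hd⟩, hed⟩)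
    exacts [⟨⟨c, hc, hec⟩, hx⟩, ⟨⟨d, hd, hed⟩, fun hx => hdc (hu d hd (hed hx))⟩]
  · rintro ⟨⟨d, hd, hed⟩, hx⟩
    obtain rfl | hdc := eq_or_ne d c
    exacts [.inl ⟨hed, hx⟩, .inr ⟨d, ⟨hdc, hd⟩, hed⟩]

theorem CNF.faces_removeClause (hd : d ∈ φ) (hne : c ≠ d) (hcd : c ⊆ d) :
    CNF.faces (φ.erase c) = φ.faces := by
  ext e
  simp only [CNF.faces, Set.mem_ofPred_eq, Finset.mem_erase]
  refine ⟨fun ⟨u, ⟨_, hu⟩, heu⟩ => ⟨u, hu, heu⟩, fun ⟨u, hu, heu⟩ => ?_⟩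
  obtain rfl | huc := eq_or_ne u c
  exacts [⟨d, ⟨hne.symm, hd⟩, heu.trans hcd⟩, ⟨u, ⟨huc, hu⟩, heu⟩]

theorem GYO.singleton_mem_faces (h : GYO φ a ψ) (hx : x ∈ removedVars a) : {x} ∈ φ.faces := by
  induction h with
  | nil => simp [removedVars] at hx
  | removeVar y c hc hy hu _ ih =>
    obtain rfl | hx : x = y ∨ _ := List.mem_cons.1 hx
    exacts [⟨c, hc, Finset.singleton_subset_iff.2 hy⟩,
      ((CNF.mem_faces_removeVar hc hu).1 (ih hx)).1]
  | removeClause c d _ hd hne hcd _ ih =>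
    exact CNF.faces_removeClause hd hne hcd ▸ ih hx

theorem GYO.nodup_removedVars (h : GYO φ a ψ) : (removedVars a).Nodup := by
  induction h with
  | nil => exact List.nodup_nil
  | removeVar x c hc _ hu h ih =>
    refine List.nodup_cons.2 ⟨fun hx => ?_, ih⟩
    simpa using ((CNF.mem_faces_removeVar hc hu).1 (h.singleton_mem_faces hx)).2
  | removeClause _ _ _ _ _ _ _ ih => exact ih

theorem GYO.var_mem (h : GYO φ a {∅}) (hx : {x} ∈ φ.faces) : GYOOp.var x ∈ a := by
  generalize hψ : ({∅} : CNF n) = ψ at h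
  induction h with
  | nil => simp [← hψ, CNF.faces] at hx
  | removeVar y c hc _ hu _ ih =>
    obtain rfl | hxy := eq_or_ne x y
    · exact List.mem_cons_self
    · exact List.mem_cons_of_mem _
        (ih ((CNF.mem_faces_removeVar hc hu).2 ⟨hx, by simpa using hxy.symm⟩) hψ)
  | removeClause c d _ hd hne hcd _ ih =>
    exact List.mem_cons_of_mem _ (ih (CNF.faces_removeClause hd hne hcd ▸ hx) hψ)

/-- Until the first variable of `c ∪ d` is removed, the two sets stay faces; as that variable is
`x`, it lies in both, and so the only clause that contains `x` at this point contains `c ∪ d`. -/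
theorem GYO.union_mem_faces (h : GYO φ a {∅}) (hσ : ReversesRemovals σ a)
    (hc : c ∈ φ.faces) (hd : d ∈ φ.faces) (hxc : x ∈ c) (hxd : x ∈ d)
    (hmax : ∀ y ∈ c ∪ d, σ.symm y ≤ σ.symm x) : c ∪ d ∈ φ.faces := by
  generalize hψ : ({∅} : CNF n) = ψ at h
  induction h with
  | nil =>
    subst hψ
    obtain ⟨e, he, hce⟩ := hc
    obtain rfl := Finset.mem_singleton.1 he
    exact absurd (hce hxc) (Finset.notMem_empty x)
  | @removeVar φ _ a y b hb _ hu h ih =>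
    subst hψ
    obtain rfl | hxy := eq_or_ne x y
    · obtain ⟨c', hc', hcc'⟩ := hc
      obtain ⟨d', hd', hdd'⟩ := hd
      obtain rfl := hu c' hc' (hcc' hxc)
      obtain rfl := hu d' hd' (hdd' hxd)
      exact ⟨d', hd', Finset.union_subset hcc' hdd'⟩
    · have hx : {x} ∈ CNF.faces (insert (b.erase y) (φ.erase b)) :=
        (CNF.mem_faces_removeVar hb hu).2
          ⟨hc.imp fun e he => ⟨he.1, Finset.singleton_subset_iff.2 (he.2 hxc)⟩,
            by simpa using hxy.symm⟩
      have hlt : σ.symm x < σ.symm y :=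
        hσ y x ((List.singleton_sublist.2 (h.var_mem hx)).cons_cons _)
      have hy : y ∉ c ∪ d := fun hy => (hmax y hy).not_gt hlt
      rw [Finset.notMem_union] at hy
      exact ((CNF.mem_faces_removeVar hb hu).1 <| ih (fun u v huv => hσ u v (huv.cons _))
        ((CNF.mem_faces_removeVar hb hu).2 ⟨hc, hy.1⟩)
        ((CNF.mem_faces_removeVar hb hu).2 ⟨hd, hy.2⟩) rfl).1
  | removeClause b b' _ hb' hne hsub _ ih =>
    rw [CNF.faces_removeClause hb' hne hsub] at ih
    exact ih (fun u v huv => hσ u v (huv.cons _)) hc hd hψ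

theorem CNF.mem_delta {i : Fin n} :
    c ∈ φ.delta σ i ↔ c ∈ φ ∧ σ i ∈ c ∧ ∀ y ∈ c, σ.symm y ≤ i := by
  simp only [CNF.delta, CNF.initialPart, Finset.mem_sdiff, Finset.mem_filter, Order.lt_add_one_iff,
    Fin.val_fin_le, Fin.val_fin_lt, not_and, not_forall, not_lt]
  constructor
  · rintro ⟨⟨hc, hle⟩, hge⟩
    obtain ⟨y, hy, hiy⟩ := hge hc
    exact ⟨hc, by simpa [← (hle y hy).antisymm hiy] using hy, hle⟩
  · rintro ⟨hc, hi, hle⟩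
    exact ⟨⟨hc, hle⟩, fun _ => ⟨σ i, hi, by simp⟩⟩

theorem CNF.exists_mem_delta (σ : Equiv.Perm (Fin n)) (hc : c ∈ φ) (h0 : c.Nonempty) :
    ∃ i, c ∈ φ.delta σ i := by
  obtain ⟨x, hx, hmax⟩ := c.exists_max_image σ.symm h0
  exact ⟨σ.symm x, CNF.mem_delta.2 ⟨hc, by simpa using hx, hmax⟩⟩

theorem GYO.isDegenerateVia (h : GYO φ a {∅}) (hφ : IsAntichain (· ⊆ ·) (φ : Set (Finset (Fin n))))
    (hσ : ReversesRemovals σ a) : φ.IsDegenerateVia 1 σ := by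
  refine fun i => Finset.card_le_one.2 fun c hc d hd => ?_
  rw [CNF.mem_delta] at hc hd
  obtain ⟨e, he, hcde⟩ := h.union_mem_faces hσ ⟨c, hc.1, subset_rfl⟩ ⟨d, hd.1, subset_rfl⟩
    hc.2.1 hd.2.1 (by simpa [or_imp, forall_and] using ⟨hc.2.2, hd.2.2⟩)
  obtain ⟨hce, hde⟩ := Finset.union_subset_iff.1 hcde
  exact (hφ.eq hc.1 he hce).trans (hφ.eq hd.1 he hde).symm

theorem idxOf_lt_idxOf_of_sublist {α : Type*} [DecidableEq α] {l : List α} (hl : l.Nodup)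
    {x y : α} (hxy : [x, y].Sublist l) : l.idxOf x < l.idxOf y := by
  have hpair : l.Pairwise fun x y => l.idxOf x < l.idxOf y := by
    rw [List.pairwise_iff_getElem]
    intro i j _ _ hij
    rwa [hl.idxOf_getElem, hl.idxOf_getElem]
  simpa using hpair.sublist hxy

theorem GYO.exists_reversesRemovals (h : GYO φ a ψ) :
    ∃ σ : Equiv.Perm (Fin n), ReversesRemovals σ a := by
  let rank (x : Fin n) : ℕᵒᵈ := OrderDual.toDual ((removedVars a).idxOf x)
  refine ⟨Tuple.sort rank, fun x y hxy => ?_⟩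
  by_contra! hle
  have hrank : rank x ≤ rank y := by simpa using Tuple.monotone_sort rank hle
  have hsub : [x, y].Sublist (removedVars a) := hxy.filterMap GYOOp.removedVar
  exact hrank.not_gt (idxOf_lt_idxOf_of_sublist h.nodup_removedVars hsub)

theorem CNF.AlphaAcyclic.isDegenerate (h : φ.AlphaAcyclic)
    (hφ : IsAntichain (· ⊆ ·) (φ : Set (Finset (Fin n)))) : φ.IsDegenerate 1 := by
  obtain rfl | ⟨a, ha⟩ := h
  · exact ⟨1, fun i => by simp [CNF.delta, CNF.initialPart]⟩
  · obtain ⟨σ, hσ⟩ := ha.exists_reversesRemovals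
    exact ⟨σ, ha.isDegenerateVia hφ hσ⟩

theorem CNF.IsDegenerate.exists_card_filter_le (h : φ.IsDegenerate k) (hψ : ψ ⊆ φ)
    (hc : c ∈ ψ) (h0 : c.Nonempty) : ∃ d ∈ ψ, ∃ x ∈ d, (ψ.filter (x ∈ ·)).card ≤ k := by
  obtain ⟨σ, hσ⟩ := h
  have hvars : (ψ.biUnion id).Nonempty := h0.mono (Finset.subset_biUnion_of_mem id hc)
  obtain ⟨x, hx, hmax⟩ := Finset.exists_max_image _ σ.symm hvars
  obtain ⟨d, hd, hxd⟩ := Finset.mem_biUnion.1 hx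
  refine ⟨d, hd, x, hxd, le_trans (Finset.card_le_card fun e he => ?_) (hσ (σ.symm x))⟩
  obtain ⟨he, hxe⟩ := Finset.mem_filter.1 he
  exact CNF.mem_delta.2 ⟨hψ he, by simpa using hxe, fun y hy =>
    hmax y (Finset.mem_biUnion.2 ⟨e, he, hy⟩)⟩

theorem CNF.IsDegenerate.card_le (h : φ.IsDegenerate k) (h0 : ∀ c ∈ φ, c.Nonempty) :
    φ.card ≤ k * n := by
  obtain ⟨σ, hσ⟩ := h
  have hcover : φ ⊆ Finset.univ.biUnion (φ.delta σ) := fun c hc => by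
    simpa using CNF.exists_mem_delta σ hc (h0 c hc)
  calc φ.card ≤ (Finset.univ.biUnion (φ.delta σ)).card := Finset.card_le_card hcover
    _ ≤ (Finset.univ : Finset (Fin n)).card * k :=
      Finset.card_biUnion_le_card_mul _ _ _ fun i _ => hσ i
    _ = k * n := by rw [Finset.card_fin, mul_comm]

end Degenerate

/-! ### The search tree of minimal transversals -/

section Search

variable {α : Type*} {P : Finset α → Prop} {l : List α} {c : ℕ → List α} {j : ℕ}
  {s T T' : Finset α} {o o' : Option α} {x : α}

/-- `s` has an element in common with the clause `l`. -/
def Meets (l : List α) (s : Finset α) : Prop :=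
  ∃ x ∈ l, x ∈ s

/-- `s` meets the first `j` clauses of the sequence `c`, so that `Minimal (MeetsFirst c j) s` says
that `s` is a minimal transversal of these clauses. -/
def MeetsFirst (c : ℕ → List α) (j : ℕ) (s : Finset α) : Prop :=
  ∀ q < j, Meets (c q) s

theorem monotone_meets (l : List α) : Monotone (Meets l) :=
  fun _ _ hst h => h.imp fun _ hx => ⟨hx.1, hst hx.2⟩

theorem monotone_meetsFirst (c : ℕ → List α) (j : ℕ) : Monotone (MeetsFirst c j) :=
  fun _ _ hst h q hq => monotone_meets (c q) hst (h q hq)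

theorem meetsFirst_succ (c : ℕ → List α) (j : ℕ) :
    MeetsFirst c (j + 1) = MeetsFirst c j ⊓ Meets (c j) :=
  funext fun _ => propext Nat.forall_lt_succ_right

theorem minimal_meetsFirst_zero : Minimal (MeetsFirst c 0) T ↔ T = ∅ := by
  have htrue : MeetsFirst c 0 = ⊤ := funext fun s => by simp [MeetsFirst]
  rw [htrue]
  exact minimal_true.trans isMin_iff_eq_bot

/-- The options for passing from a minimal transversal of some clauses to one that also meets a
further clause `l`: keep the set (`none`), or add an element of `l`. The order is that in which the
search tries them. -/
def options (l : List α) : List (Option α) :=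
  none :: l.map some

theorem nodup_options (hl : l.Nodup) : (options l).Nodup := by
  simpa [options] using hl.map (Option.some_injective α)

variable [DecidableEq α]

/-- The set to which an option leads from `T`. -/
def extend (T : Finset α) : Option α → Finset α
  | none => T
  | some x => insert x T

/-- The option `o` leads from `T` to a minimal set that satisfies `P` and meets `l`, and `o` does
not add an element that `T` already contains. -/
def Admissible (P : Finset α → Prop) (l : List α) (T : Finset α) (o : Option α) : Prop :=
  (∀ x ∈ o, x ∉ T) ∧ Minimal (P ⊓ Meets l) (extend T o)

theorem Admissible.not_meets (hT : P T) (h : Admissible P l T (some x)) : ¬ Meets l T := fun hl =>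
  h.1 x rfl (h.2.le_of_le ⟨hT, hl⟩ (Finset.subset_insert x T) (Finset.mem_insert_self x T))

theorem Admissible.not_minimal (hT : P T) (h : Admissible P l T (some x)) :
    ¬ Minimal P (extend T (some x)) := fun hmin =>
  h.1 x rfl (hmin.le_of_le hT (Finset.subset_insert x T) (Finset.mem_insert_self x T))

theorem Admissible.eq_of_mem (hT : P T) (h : Admissible P l T (some x)) {y : α} (hy : y ∈ l)
    (hyT : y ∈ extend T (some x)) : y = x :=
  (Finset.mem_insert.1 hyT).resolve_right fun hyT => h.not_meets hT ⟨y, hy, hyT⟩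

theorem Admissible.parent_unique (hT : Minimal P T) (hT' : Minimal P T') (h : Admissible P l T o)
    (h' : Admissible P l T' o') (heq : extend T o = extend T' o') : T = T' ∧ o = o' := by
  match o, o' with
  | none, none => exact ⟨heq, rfl⟩
  | none, some x => exact absurd (heq ▸ hT) (h'.not_minimal hT'.prop)
  | some x, none => exact absurd (heq ▸ hT') (h.not_minimal hT.prop)
  | some x, some x' =>
    obtain ⟨y, hy, hyT⟩ := h.2.prop.2
    obtain rfl := h.eq_of_mem hT.prop hy hyT
    obtain rfl := h'.eq_of_mem hT'.prop hy (heq ▸ hyT)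
    refine ⟨?_, rfl⟩
    rw [← Finset.erase_insert (h.1 y rfl), ← Finset.erase_insert (h'.1 y rfl)]
    exact congrArg (·.erase y) heq

/-- If `s` is not minimal for `P`, then some element of `s` is only needed in order to meet `l`. -/
theorem exists_parent (hP : Monotone P) (h : Minimal (P ⊓ Meets l) s) :
    ∃ T, Minimal P T ∧ ∃ o ∈ options l, Admissible P l T o ∧ extend T o = s := by
  by_cases hs : Minimal P s
  · exact ⟨s, hs, none, List.mem_cons_self, ⟨by simp, h⟩, rfl⟩
  obtain ⟨x, hx, hPx⟩ : ∃ x ∈ s, P (s.erase x) := by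
    rw [Finset.minimal_iff_forall_erase fun _ _ h hle => hP hle h] at hs
    simpa using mt (And.intro h.prop.1) hs
  have hext : extend (s.erase x) (some x) = s := Finset.insert_erase hx
  have hmiss : ¬ Meets l (s.erase x) := fun hl =>
    Finset.notMem_erase x s (h.le_of_le ⟨hPx, hl⟩ (Finset.erase_subset x s) hx)
  have hxl : x ∈ l := by
    obtain ⟨y, hy, hys⟩ := h.prop.2
    obtain rfl | hyx := eq_or_ne y x
    exacts [hy, absurd ⟨y, hy, Finset.mem_erase.2 ⟨hyx, hys⟩⟩ hmiss]
  refine ⟨s.erase x, (Finset.minimal_iff_forall_erase fun _ _ h hle => hP hle h).2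
    ⟨hPx, fun y hy hPy => ?_⟩, some x, by simp [options, hxl],
    ⟨by simp, hext.symm ▸ h⟩, hext⟩
  obtain ⟨hyx, hys⟩ := Finset.mem_erase.1 hy
  have hle : (s.erase x).erase y ≤ s.erase y :=
    Finset.erase_subset_erase y (Finset.erase_subset x s)
  exact Finset.notMem_erase y s (h.le_of_le
    ⟨hP hle hPy, x, hxl, Finset.mem_erase.2 ⟨hyx.symm, hx⟩⟩ (Finset.erase_subset y s) hys)

theorem exists_admissible (hP : Monotone P) (hx : x ∈ l) (hPx : ∀ s, P (insert x s) → P s)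
    (hT : Minimal P T) : ∃ o ∈ options l, Admissible P l T o := by
  by_cases hmeets : Meets l T
  · exact ⟨none, List.mem_cons_self, by simp,
      ⟨⟨hT.prop, hmeets⟩, fun _ hs hle => hT.le_of_le hs.1 hle⟩⟩
  have hxT : x ∉ T := fun hxT => hmeets ⟨x, hx, hxT⟩
  refine ⟨some x, by simp [options, hx], by simpa using hxT, ?_⟩
  rw [Finset.minimal_iff_forall_erase fun _ _ h hle => (hP.inf (monotone_meets l)) hle h]
  refine ⟨⟨hP (Finset.subset_insert x T) hT.prop, x, hx, Finset.mem_insert_self x T⟩, ?_⟩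
  rintro y hy ⟨hPy, hly⟩
  obtain rfl | hyx := eq_or_ne y x
  · exact hmeets (by simpa [extend, hxT] using hly)
  · have hyT := (Finset.mem_insert.1 hy).resolve_left hyx
    rw [extend, Finset.erase_insert_of_ne hyx.symm] at hPy
    exact Finset.notMem_erase y T (hT.le_of_le (hPx _ hPy) (Finset.erase_subset y T) hyT)

open Classical in
/-- The children of the node `T` of the search tree that are reached by the options in `os`. -/
noncomputable def children (P : Finset α → Prop) (l : List α) (T : Finset α)
    (os : List (Option α)) : List (Finset α) :=
  (os.filter fun o => Admissible P l T o).map (extend T)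

/-- The leaves of the search tree below the node `T` at the level `j`, `r` levels above the leaves.
At the level `j`, the nodes are the minimal transversals of the first `j` clauses. -/
noncomputable def leaves (c : ℕ → List α) : ℕ → ℕ → Finset α → List (Finset α)
  | 0, _, T => [T]
  | r + 1, j, T =>
    (children (MeetsFirst c j) (c j) T (options (c j))).flatMap (leaves c r (j + 1))

theorem mem_children {os : List (Option α)} :
    s ∈ children P l T os ↔ ∃ o ∈ os, Admissible P l T o ∧ extend T o = s := by
  simp [children, and_assoc]

theorem children_cons_of_admissible {os : List (Option α)} (h : Admissible P l T o) :
    children P l T (o :: os) = extend T o :: children P l T os := by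
  simp [children, h]

theorem children_cons_of_not_admissible {os : List (Option α)} (h : ¬ Admissible P l T o) :
    children P l T (o :: os) = children P l T os := by
  simp [children, h]

theorem nodup_children (hT : Minimal P T) {os : List (Option α)} (hos : os.Nodup) :
    (children P l T os).Nodup := by
  refine List.Nodup.map_on (fun o ho o' ho' heq => ?_) (hos.filter _)
  simp only [List.mem_filter, decide_eq_true_eq] at ho ho'
  exact (ho.2.parent_unique hT hT ho'.2 heq).2

theorem children_ne_nil (hx : x ∈ c j) (hfresh : ∀ q < j, x ∉ c q)
    (hT : Minimal (MeetsFirst c j) T) :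
    children (MeetsFirst c j) (c j) T (options (c j)) ≠ [] := by
  have hPx (s) (hs : MeetsFirst c j (insert x s)) : MeetsFirst c j s := fun q hq =>
    (hs q hq).imp fun y hy => ⟨hy.1, Finset.mem_of_mem_insert_of_ne hy.2
      (ne_of_mem_of_not_mem hy.1 (hfresh q hq))⟩
  obtain ⟨o, ho, hadm⟩ := exists_admissible (monotone_meetsFirst c j) hx hPx hT
  exact List.ne_nil_of_mem (mem_children.2 ⟨o, ho, hadm, rfl⟩)

theorem flatMap_children_spec {L : List (Finset α)} (hl : l.Nodup) (hP : Monotone P)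
    (hL : L.Nodup) (hmem : ∀ T, T ∈ L ↔ Minimal P T) :
    (L.flatMap fun T => children P l T (options l)).Nodup ∧
      ∀ s, s ∈ L.flatMap (fun T => children P l T (options l)) ↔ Minimal (P ⊓ Meets l) s := by
  constructor
  · refine List.nodup_flatMap.2 ⟨fun T hT => nodup_children ((hmem T).1 hT) (nodup_options hl), ?_⟩
    refine hL.imp_of_mem fun {T T'} hT hT' hne s hs hs' => hne ?_
    obtain ⟨o, -, ho, hs⟩ := mem_children.1 hs
    obtain ⟨o', -, ho', hs'⟩ := mem_children.1 hs'
    exact (ho.parent_unique ((hmem T).1 hT) ((hmem T').1 hT') ho' (hs.trans hs'.symm)).1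
  · intro s
    simp only [List.mem_flatMap, hmem, mem_children]
    refine ⟨?_, exists_parent hP⟩
    rintro ⟨T, -, o, -, ho, rfl⟩
    exact ho.2

theorem flatMap_leaves_spec (r j : ℕ) (hc : ∀ q < j + r, (c q).Nodup) {L : List (Finset α)}
    (hL : L.Nodup) (hmem : ∀ T, T ∈ L ↔ Minimal (MeetsFirst c j) T) :
    (L.flatMap (leaves c r j)).Nodup ∧
      ∀ s, s ∈ L.flatMap (leaves c r j) ↔ Minimal (MeetsFirst c (j + r)) s := by
  induction r generalizing j L with
  | zero =>
    have hleaves : leaves c 0 j = fun T => [T] := rfl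
    simpa [hleaves] using ⟨hL, hmem⟩
  | succ r ih =>
    have hstep := flatMap_children_spec (hc j (by omega)) (monotone_meetsFirst c j) hL hmem
    rw [← meetsFirst_succ] at hstep
    have := ih (j + 1) (fun q hq => hc q (by omega)) hstep.1 hstep.2
    rwa [List.flatMap_assoc, show j + 1 + r = j + (r + 1) by omega] at this

theorem nodup_leaves {m : ℕ} (hc : ∀ q < m, (c q).Nodup) : (leaves c m 0 ∅).Nodup := by
  simpa using (flatMap_leaves_spec m 0 (by simpa using hc) (List.nodup_singleton ∅)
    fun T => by rw [List.mem_singleton, minimal_meetsFirst_zero]).1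

theorem mem_leaves {m : ℕ} (hc : ∀ q < m, (c q).Nodup) :
    s ∈ leaves c m 0 ∅ ↔ Minimal (MeetsFirst c m) s := by
  simpa using (flatMap_leaves_spec m 0 (by simpa using hc) (List.nodup_singleton ∅)
    fun T => by rw [List.mem_singleton, minimal_meetsFirst_zero]).2 s

end Search

/-! ### Reasoning about programs -/

section ProgramLogic

variable {p q : Prog} {s s' : State} {a b T T' : ℕ} {w w' : List ℕ} {P Q : State → Prop}
  {u v : List Event}

@[simp] theorem State.reg_setReg (s : State) (r k x : ℕ) :
    (s.setReg r k).reg x = if x = r then k else s.reg x := by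
  simp [State.setReg, Function.update_apply]

@[simp] theorem State.mem_setReg (s : State) (r k : ℕ) : (s.setReg r k).mem = s.mem := rfl

@[simp] theorem State.reg_setMem (s : State) (a k : ℕ) : (s.setMem a k).reg = s.reg := rfl

theorem State.mem_setMem (s : State) (a k x : ℕ) :
    (s.setMem a k).mem x = if x = a then k else s.mem x := by
  simp [State.setMem, Function.update_apply]

/-- The register `x` is a target of an assignment in the program. -/
@[simp] def Prog.changes : Prog → ℕ → Bool
  | .set r _, x => r == x
  | .copy r _, x => r == x
  | .inc r, x => r == x
  | .dec r, x => r == x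
  | .load r _ _, x => r == x
  | .store _ _ _, _ => false
  | .write _, _ => false
  | .endItem, _ => false
  | .seq p q, x => p.changes x || q.changes x
  | .ite _ _ p q, x => p.changes x || q.changes x
  | .loop _ _ p, x => p.changes x

theorem Runs.reg_eq (h : Runs p s u s') {x : ℕ} (hx : p.changes x = false) :
    s'.reg x = s.reg x := by
  induction h <;>
    simp only [Prog.changes, Bool.or_eq_false_iff, beq_eq_false_iff_ne] at hx <;>
    first
    | rw [State.reg_setReg, if_neg (Ne.symm hx)]
    | rfl
    | simp_all

theorem written_append (u v : List Event) : written (u ++ v) = written u ++ written v := by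
  induction u with
  | nil => rfl
  | cons e u ih => cases e <;> simp [written, ih]

/-- Started in `s`, the program `p` halts after at most `T` units of time in a state with the
property `Q`. Meanwhile it writes `w`, but does not complete an item of the output. -/
def HaltsWith (p : Prog) (s : State) (T : ℕ) (w : List ℕ) (Q : State → Prop) : Prop :=
  ∃ u s', Runs p s u s' ∧ Event.endItem ∉ u ∧ written u = w ∧ u.length ≤ T ∧ Q s'

theorem HaltsWith.mono (h : HaltsWith p s T w P) (hT : T ≤ T') (hPQ : ∀ s', P s' → Q s') :
    HaltsWith p s T' w Q := by
  obtain ⟨u, s', hrun, hitem, hw, hlen, hP⟩ := h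
  exact ⟨u, s', hrun, hitem, hw, hlen.trans hT, hPQ _ hP⟩

theorem HaltsWith.frame (h : HaltsWith p s T w Q) :
    HaltsWith p s T w fun s' => Q s' ∧ ∀ x, p.changes x = false → s'.reg x = s.reg x := by
  obtain ⟨u, s', hrun, hitem, hw, hlen, hQ⟩ := h
  exact ⟨u, s', hrun, hitem, hw, hlen, hQ, fun x hx => hrun.reg_eq hx⟩

theorem HaltsWith.seq_append (hp : HaltsWith p s T w P)
    (hq : ∀ s', P s' → (∀ x, p.changes x = false → s'.reg x = s.reg x) →
      HaltsWith q s' T' w' Q) :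
    HaltsWith (.seq p q) s (T + T') (w ++ w') Q := by
  obtain ⟨u, s', hrun, hitem, rfl, hlen, hP, hframe⟩ := hp.frame
  obtain ⟨u', s'', hrun', hitem', rfl, hlen', hQ⟩ := hq s' hP hframe
  exact ⟨u ++ u', s'', hrun.seq hrun', by simp [hitem, hitem'], written_append _ _, by
    rw [List.length_append]; omega, hQ⟩

theorem HaltsWith.seq (hp : HaltsWith p s T [] P)
    (hq : ∀ s', P s' → (∀ x, p.changes x = false → s'.reg x = s.reg x) →
      HaltsWith q s' T' w Q) :
    HaltsWith (.seq p q) s (T + T') w Q :=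
  hp.seq_append hq

theorem HaltsWith.ite (hp : s.reg a < s.reg b → HaltsWith p s T w Q)
    (hq : ¬ s.reg a < s.reg b → HaltsWith q s T w Q) :
    HaltsWith (.ite a b p q) s (T + 1) w Q := by
  by_cases h : s.reg a < s.reg b
  · obtain ⟨u, s', hrun, hitem, hw, hlen, hQ⟩ := hp h
    exact ⟨_, s', .iteTrue h hrun, by simpa using hitem, hw, by simpa using hlen, hQ⟩
  · obtain ⟨u, s', hrun, hitem, hw, hlen, hQ⟩ := hq h
    exact ⟨_, s', .iteFalse h hrun, by simpa using hitem, hw, by simpa using hlen, hQ⟩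

/-- A program without loops that does not complete items of the output. -/
def Prog.isBlock : Prog → Bool
  | .endItem => false
  | .loop _ _ _ => false
  | .seq p q => p.isBlock && q.isBlock
  | .ite _ _ p q => p.isBlock && q.isBlock
  | _ => true

/-- The state in which a block halts (a meaningless value for other programs). -/
@[simp] def Prog.eval : Prog → State → State
  | .set r k, s => s.setReg r k
  | .copy r r', s => s.setReg r (s.reg r')
  | .inc r, s => s.setReg r (s.reg r + 1)
  | .dec r, s => s.setReg r (s.reg r - 1)
  | .load r a i, s => s.setReg r (s.mem (s.reg a + s.reg i))
  | .store a i r, s => s.setMem (s.reg a + s.reg i) (s.reg r)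
  | .write _, s => s
  | .endItem, s => s
  | .seq p q, s => q.eval (p.eval s)
  | .ite a b p q, s => if s.reg a < s.reg b then p.eval s else q.eval s
  | .loop _ _ _, s => s

/-- The output of a block (a meaningless value for other programs). -/
@[simp] def Prog.output : Prog → State → List ℕ
  | .write r, s => [s.reg r]
  | .seq p q, s => p.output s ++ q.output (p.eval s)
  | .ite a b p q, s => if s.reg a < s.reg b then p.output s else q.output s
  | _, _ => []

/-- A bound for the running time of a block (a meaningless value for other programs). -/
def Prog.cost : Prog → ℕ
  | .seq p q => p.cost + q.cost
  | .ite _ _ p q => max p.cost q.cost + 1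
  | _ => 1

theorem HaltsWith.block_output (hp : p.isBlock = true) (s : State) :
    HaltsWith p s p.cost (p.output s) (· = p.eval s) := by
  induction p generalizing s with
  | set r k => exact ⟨_, _, .set s r k, by simp, rfl, le_rfl, rfl⟩
  | copy r k => exact ⟨_, _, .copy s r k, by simp, rfl, le_rfl, rfl⟩
  | inc r => exact ⟨_, _, .inc s r, by simp, rfl, le_rfl, rfl⟩
  | dec r => exact ⟨_, _, .dec s r, by simp, rfl, le_rfl, rfl⟩
  | load r a i => exact ⟨_, _, .load s r a i, by simp, rfl, le_rfl, rfl⟩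
  | store a i r => exact ⟨_, _, .store s a i r, by simp, rfl, le_rfl, rfl⟩
  | write r => exact ⟨_, _, .write s r, by simp, rfl, le_rfl, rfl⟩
  | endItem => simp [Prog.isBlock] at hp
  | loop a b p => simp [Prog.isBlock] at hp
  | seq p q ihp ihq =>
    simp only [Prog.isBlock, Bool.and_eq_true] at hp
    exact (ihp hp.1 s).seq_append fun s' hs' _ => by subst hs'; exact ihq hp.2 _
  | ite a b p q ihp ihq =>
    simp only [Prog.isBlock, Bool.and_eq_true] at hp
    refine HaltsWith.ite (fun h => ?_) fun h => ?_
    · simpa [h] using (ihp hp.1 s).mono (le_max_left _ _) fun _ => id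
    · simpa [h] using (ihq hp.2 s).mono (le_max_right _ _) fun _ => id

/-- A program that does not write. -/
def Prog.isSilent : Prog → Bool
  | .write _ => false
  | .seq p q => p.isSilent && q.isSilent
  | .ite _ _ p q => p.isSilent && q.isSilent
  | _ => true

theorem Prog.output_eq_nil (hp : p.isSilent = true) (s : State) : p.output s = [] := by
  induction p generalizing s with
  | seq p q ihp ihq =>
    simp only [Prog.isSilent, Bool.and_eq_true] at hp
    simp [ihp hp.1, ihq hp.2]
  | ite a b p q ihp ihq =>
    simp only [Prog.isSilent, Bool.and_eq_true] at hp
    simp [ihp hp.1, ihq hp.2]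
  | write r => simp [Prog.isSilent] at hp
  | _ => rfl

theorem HaltsWith.block (hp : p.isBlock = true) (hsilent : p.isSilent = true) (hT : p.cost ≤ T)
    (hQ : Q (p.eval s)) : HaltsWith p s T [] Q := by
  rw [← Prog.output_eq_nil hsilent s]
  exact (HaltsWith.block_output hp s).mono hT fun s' hs' => hs' ▸ hQ

theorem HaltsWith.block_seq (hp : p.isBlock = true) (hsilent : p.isSilent = true)
    (hq : HaltsWith q (p.eval s) T w Q) : HaltsWith (.seq p q) s (p.cost + T) w Q :=
  (HaltsWith.block (Q := (· = p.eval s)) hp hsilent le_rfl rfl).seq fun _ hs' _ => hs' ▸ hq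

/-- `for R[i] < R[l] do p`, with `R[i]` counting up from `0` -/
def Prog.forTo (i l : ℕ) (p : Prog) : Prog :=
  .seq (.set i 0) (.loop i l (.seq p (.inc i)))

@[simp] theorem Prog.changes_forTo (i l : ℕ) (p : Prog) (x : ℕ) :
    (Prog.forTo i l p).changes x = (i == x || p.changes x) := by
  simp only [Prog.forTo, Prog.changes]
  grind

variable {i l K c : ℕ} {I : ℕ → State → Prop}

theorem HaltsWith.countingLoop (hil : l ≠ i) (hi : p.changes i = false)
    (hl : p.changes l = false) (c : ℕ → ℕ) (w : ℕ → List ℕ)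
    (hstep : ∀ k < K, ∀ s', I k s' → s'.reg i = k → s'.reg l = K →
      HaltsWith p s' (c k) (w k) fun s'' => I (k + 1) (s''.setReg i (k + 1)))
    (r k : ℕ) (hk : k + r = K) (s : State) (hI : I k s) (hsi : s.reg i = k) (hsl : s.reg l = K) :
    HaltsWith (.loop i l (.seq p (.inc i))) s (((List.range' k r).map (c · + 2)).sum + 1)
      ((List.range' k r).flatMap w) (I K) := by
  induction r generalizing k s with
  | zero => exact ⟨_, s, .loopFalse (by omega), by simp, rfl, by simp, by rwa [← hk]⟩
  | succ r ih =>
    obtain ⟨u, s₁, hrun, hitem, hw, hlen, hI₁, hframe⟩ :=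
      (hstep k (by omega) s hI hsi hsl).frame
    have hinc := Runs.inc s₁ i
    rw [(hframe i hi).trans hsi] at hinc
    obtain ⟨u', s₂, hrun', hitem', hw', hlen', hI₂⟩ := ih (k + 1) (by omega)
      (s₁.setReg i (k + 1)) hI₁ (by simp) (by simp [hil, hframe l hl, hsl])
    refine ⟨_, s₂, .loopTrue (by omega) (hrun.seq hinc) hrun', by simp [hitem, hitem'], ?_, ?_,
      hI₂⟩
    · simp [written, written_append, hw, hw', List.range'_succ]
    · simp only [List.length_cons, List.length_append, List.length_nil, List.range'_succ,
        List.map_cons, List.sum_cons]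
      omega

theorem HaltsWith.forTo_sum (hil : l ≠ i) (hi : p.changes i = false)
    (hl : p.changes l = false) (hK : s.reg l = K) (c : ℕ → ℕ) (w : ℕ → List ℕ)
    (hI : I 0 (s.setReg i 0))
    (hstep : ∀ k < K, ∀ s', I k s' → s'.reg i = k → s'.reg l = K →
      HaltsWith p s' (c k) (w k) fun s'' => I (k + 1) (s''.setReg i (k + 1))) :
    HaltsWith (.forTo i l p) s (((List.range K).map (c · + 2)).sum + 2)
      ((List.range K).flatMap w) (I K) := by
  rw [List.range_eq_range']
  have hloop := HaltsWith.countingLoop hil hi hl c w hstep K 0 (zero_add K) (s.setReg i 0) hI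
    (by simp) (by simp [hil, hK])
  exact (HaltsWith.block_seq (p := .set i 0) rfl rfl hloop).mono
    (by simp only [Prog.cost]; omega) fun _ => id

theorem HaltsWith.forTo_output (hil : l ≠ i) (hi : p.changes i = false)
    (hl : p.changes l = false) (hK : s.reg l = K) (w : ℕ → List ℕ) (hI : I 0 (s.setReg i 0))
    (hstep : ∀ k < K, ∀ s', I k s' → s'.reg i = k → s'.reg l = K →
      HaltsWith p s' c (w k) fun s'' => I (k + 1) (s''.setReg i (k + 1))) :
    HaltsWith (.forTo i l p) s (K * (c + 2) + 2) ((List.range K).flatMap w) (I K) := by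
  simpa using HaltsWith.forTo_sum hil hi hl hK (fun _ => c) w hI hstep

theorem HaltsWith.forTo (hil : l ≠ i) (hi : p.changes i = false) (hl : p.changes l = false)
    (hK : s.reg l = K) (hI : I 0 (s.setReg i 0))
    (hstep : ∀ k < K, ∀ s', I k s' → s'.reg i = k → s'.reg l = K →
      HaltsWith p s' c [] fun s'' => I (k + 1) (s''.setReg i (k + 1))) :
    HaltsWith (.forTo i l p) s (K * (c + 2) + 2) [] (I K) := by
  have hout := HaltsWith.forTo_output hil hi hl hK (fun _ => []) hI hstep
  rwa [List.flatMap_eq_nil_iff.2 fun _ _ => rfl] at hout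

end ProgramLogic

/-! ### Output with delay -/

section Output

variable {p q : Prog} {s : State} {a b T T' c D F F' : ℕ} {w : List ℕ} {ws : List (List ℕ)}
  {P Q : State → Prop} {u v : List Event}

/-- `OutputsWithDelay`, with a separate bound `F` for the time until the first item is complete
(or until the machine halts, if there is none). -/
def OutputsFrom (D F : ℕ) (u : List Event) : List (List ℕ) → Prop
  | [] => Event.endItem ∉ u ∧ written u = [] ∧ u.length ≤ F
  | w :: ws => ∃ v u', u = v ++ Event.endItem :: u' ∧ Event.endItem ∉ v ∧ v.length + 1 ≤ F ∧
      written v = w ∧ OutputsWithDelay D u' ws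

theorem OutputsFrom.outputsWithDelay (h : OutputsFrom D F u ws) (hF : F ≤ D) :
    OutputsWithDelay D u ws := by
  cases ws with
  | nil => exact .halt u h.1 h.2.1 (h.2.2.trans hF)
  | cons w ws =>
    obtain ⟨v, u', rfl, hitem, hlen, rfl, htail⟩ := h
    exact .item v hitem (hlen.trans hF) htail

theorem OutputsFrom.append (h : OutputsFrom D F u ws) (hitem : Event.endItem ∉ v)
    (hwritten : written v = []) (hlen : v.length + F ≤ F') : OutputsFrom D F' (v ++ u) ws := by
  cases ws with
  | nil =>
    have hu := h.2.2
    exact ⟨by simp [hitem, h.1], by simp [written_append, hwritten, h.2.1], by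
      rw [List.length_append]; omega⟩
  | cons w ws =>
    obtain ⟨v', u', rfl, hitem', hlen', rfl, htail⟩ := h
    exact ⟨v ++ v', u', by simp, by simp [hitem, hitem'], by rw [List.length_append]; omega,
      by simp [written_append, hwritten], htail⟩

/-- Started in `s`, the program `p` writes `w`, completes an item of the output, and halts in a
state with the property `Q`, where at most `T` units of time pass before the item is complete, and
at most `T` afterwards. -/
def HaltsWithItem (p : Prog) (s : State) (T : ℕ) (w : List ℕ) (Q : State → Prop) : Prop :=
  ∃ u v s', Runs p s (u ++ .endItem :: v) s' ∧ Event.endItem ∉ u ∧ Event.endItem ∉ v ∧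
    written u = w ∧ written v = [] ∧ u.length + 1 ≤ T ∧ v.length ≤ T ∧ Q s'

theorem HaltsWithItem.mono (h : HaltsWithItem p s T w P) (hT : T ≤ T')
    (hPQ : ∀ s', P s' → Q s') : HaltsWithItem p s T' w Q := by
  obtain ⟨u, v, s', hrun, hu, hv, hwu, hwv, hlu, hlv, hP⟩ := h
  exact ⟨u, v, s', hrun, hu, hv, hwu, hwv, hlu.trans hT, hlv.trans hT, hPQ _ hP⟩

theorem HaltsWith.seq_item (hp : HaltsWith p s T [] P)
    (hq : ∀ s', P s' → HaltsWithItem q s' T' w Q) : HaltsWithItem (.seq p q) s (T + T') w Q := by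
  obtain ⟨u, s', hrun, hitem, hw, hlen, hP⟩ := hp
  obtain ⟨u', v, s'', hrun', hu, hv, hwu, hwv, hlu, hlv, hQ⟩ := hq s' hP
  refine ⟨u ++ u', v, s'', by simpa using hrun.seq hrun', by simp [hitem, hu], hv, ?_, hwv, ?_,
    by omega, hQ⟩
  · simp [written_append, hw, hwu]
  · rw [List.length_append]; omega

theorem HaltsWithItem.ite_false (h : ¬ s.reg a < s.reg b) (hq : HaltsWithItem q s T w Q) :
    HaltsWithItem (.ite a b p q) s (T + 1) w Q := by
  obtain ⟨u, v, s', hrun, hu, hv, hwu, hwv, hlu, hlv, hQ⟩ := hq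
  exact ⟨.tick :: u, v, s', .iteFalse h hrun, by simpa using hu, hv, hwu, hwv, by simpa using hlu,
    by omega, hQ⟩

theorem HaltsWith.endItem_seq (hp : HaltsWith p s T w P)
    (hq : ∀ s', P s' → (∀ x, p.changes x = false → s'.reg x = s.reg x) →
      HaltsWith q s' T [] Q) :
    HaltsWithItem (.seq p (.seq .endItem q)) s (T + 1) w Q := by
  obtain ⟨u, s', hrun, hu, hwu, hlu, hP, hframe⟩ := hp.frame
  obtain ⟨v, s'', hrun', hv, hwv, hlv, hQ⟩ := hq s' hP hframe
  exact ⟨u, v, s'', hrun.seq ((Runs.endItem s').seq hrun'), hu, hv, hwu, hwv, by omega, by omega,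
    hQ⟩

/-- Started in `s`, the program `p` halts, lists `ws` with delay `D`, and takes at most `F` units of
time for the first item (until it halts, if there is none). -/
def Outputs (p : Prog) (D F : ℕ) (s : State) (ws : List (List ℕ)) : Prop :=
  ∃ u s', Runs p s u s' ∧ OutputsFrom D F u ws

theorem HaltsWith.outputs (h : HaltsWith p s F [] Q) : Outputs p D F s [] := by
  obtain ⟨u, s', hrun, hitem, hw, hlen, -⟩ := h
  exact ⟨u, s', hrun, hitem, hw, hlen⟩

theorem HaltsWith.seq_outputs (hp : HaltsWith p s T [] P)
    (hq : ∀ s', P s' → (∀ x, p.changes x = false → s'.reg x = s.reg x) → Outputs q D F s' ws) :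
    Outputs (.seq p q) D (T + F) s ws := by
  obtain ⟨u, s', hrun, hitem, hw, hlen, hP, hframe⟩ := hp.frame
  obtain ⟨u', s'', hrun', hout⟩ := hq s' hP hframe
  exact ⟨u ++ u', s'', hrun.seq hrun', hout.append hitem hw (by omega)⟩

theorem Outputs.ite (hp : s.reg a < s.reg b → Outputs p D F s ws)
    (hq : ¬ s.reg a < s.reg b → Outputs q D F s ws) : Outputs (.ite a b p q) D (F + 1) s ws := by
  by_cases hab : s.reg a < s.reg b
  · obtain ⟨u, s', hrun, hout⟩ := hp hab
    exact ⟨_, s', .iteTrue hab hrun, hout.append (v := [.tick]) (by simp) rfl (by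
      rw [List.length_singleton, add_comm])⟩
  · obtain ⟨u, s', hrun, hout⟩ := hq hab
    exact ⟨_, s', .iteFalse hab hrun, hout.append (v := [.tick]) (by simp) rfl (by
      rw [List.length_singleton, add_comm])⟩

theorem Outputs.loop_halt (hab : ¬ s.reg a < s.reg b) : Outputs (.loop a b p) D 1 s [] :=
  ⟨_, _, .loopFalse hab, by simp, rfl, by simp⟩

theorem Outputs.loop_step (hab : s.reg a < s.reg b)
    (h : HaltsWith p s c [] fun s' => Outputs (.loop a b p) D F s' ws) (hF : F + c + 1 ≤ F') :
    Outputs (.loop a b p) D F' s ws := by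
  obtain ⟨u, s', hrun, hitem, hw, hlen, u', s'', hrun', hout⟩ := h
  refine ⟨.tick :: (u ++ u'), s'', .loopTrue hab hrun hrun', ?_⟩
  refine hout.append (v := .tick :: u) (by simpa using hitem) hw ?_
  rw [List.length_cons]; omega

theorem Outputs.loop_item (hab : s.reg a < s.reg b)
    (h : HaltsWithItem p s c w fun s' => Outputs (.loop a b p) D F s' ws)
    (hD : F + c ≤ D) (hF : c + 1 ≤ F') : Outputs (.loop a b p) D F' s (w :: ws) := by
  obtain ⟨u, v, s', hrun, hu, hv, rfl, hwv, hlu, hlv, u', s'', hrun', hout⟩ := h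
  refine ⟨_, s'', .loopTrue hab hrun hrun', .tick :: u, v ++ u', by simp, by simpa using hu, ?_,
    rfl, (hout.append hv hwv le_rfl).outputsWithDelay (by omega)⟩
  rw [List.length_cons]; omega

end Output

/-! ### The dualization program -/

infixr:60 " ;; " => Prog.seq

/-! The registers `rZ`, `rN`, `rM` hold zero and the numbers of variables and of clauses, and `rO`,
`rC`, `rT`, `rH` the base addresses of the arrays: the addresses of the clauses, a counter for each
variable, the indicator function of the current set, and the stack of the options chosen on the
path to the current node of the search tree. The search is at the option `rI` of the level `rJ`,
until `rGo` is zero. -/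

notation "rZ" => 0
notation "rN" => 1
notation "rM" => 2
notation "rO" => 3
notation "rC" => 4
notation "rT" => 5
notation "rH" => 6
notation "rJ" => 7
notation "rI" => 8
notation "rGo" => 9
notation "rP" => 10
notation "rLen" => 11
notation "rQ" => 12
notation "rE" => 13
notation "rX" => 14
notation "rV" => 15
notation "rW" => 16
notation "rCnt" => 17
notation "rOk" => 18
notation "rL" => 19
notation "rF" => 20
notation "rK" => 21
notation "rD" => 22

/-- A step without effect: the register `rD` is never read. -/
def Prog.nop : Prog := .set rD 0

/-- Runs through the clauses of the input, with `rP` at the address of the clause. -/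
def Prog.walk (body : Prog) : Prog :=
  .set rP 2 ;; .forTo rQ rM (body ;; .load rLen rP rZ ;; .inc rP ;; .forTo rE rLen (.inc rP))

/-- Finds the end of the input, and an empty clause. -/
def Prog.skim : Prog :=
  .set rOk 1 ;; .walk (.load rLen rP rZ ;; .ite rZ rLen .nop (.set rOk 0))

/-- Places the arrays behind the input. -/
def Prog.allocate : Prog :=
  .copy rO rP ;; .copy rC rO ;; .forTo rE rN (.inc rC) ;; .copy rT rC ;; .forTo rE rN (.inc rT) ;;
    .copy rH rT ;; .forTo rE rN (.inc rH)

/-- Stores the addresses of the clauses. -/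
def Prog.index : Prog := .walk (.store rO rQ rP)

/-- Resets the counters. -/
def Prog.clear : Prog := .forTo rE rN (.store rC rE rZ)

/-- Runs through the elements of the clause at the address `rP`. -/
def Prog.scanClause (body : Prog) : Prog :=
  .forTo rE rLen (.inc rP ;; .load rX rP rZ ;; body)

/-- Runs through the elements of the first `rL` clauses. -/
def Prog.scan (pre body post : Prog) : Prog :=
  .forTo rQ rL (.load rP rO rQ ;; .load rLen rP rZ ;; pre ;; .scanClause body ;; post)

/-- Counts the occurrences of the variables in the first `rL` clauses. -/
def Prog.count : Prog :=
  .scan .nop (.load rV rC rX ;; .inc rV ;; .store rC rX rV) .nop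

/-- Finds one of the first `rL` clauses that contains a variable with a counter below `2`. -/
def Prog.find : Prog :=
  .set rF 0 ;; .scan .nop
    (.load rV rC rX ;; .set rW 2 ;; .ite rV rW (.copy rF rQ) .nop) .nop

/-- Exchanges the clause `rF` and the last one of the first `rL` clauses, and lowers `rL`. -/
def Prog.moveLast : Prog :=
  .dec rL ;; .load rV rO rF ;; .load rW rO rL ;; .store rO rF rW ;; .store rO rL rV

/-- Arranges the clauses such that each of them contains a variable that does not occur in the
clauses before it. -/
def Prog.arrange : Prog :=
  .copy rL rM ;; .forTo rK rM (.clear ;; .count ;; .find ;; .moveLast)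

/-- Counts the common elements of the current set and the clause, and notes the last one. -/
def Prog.countCommon : Prog :=
  .load rV rT rX ;; .ite rZ rV (.inc rCnt ;; .copy rW rX) .nop

/-- Fails if there is no common element, and marks it if there is only one. -/
def Prog.markSole : Prog :=
  .ite rZ rCnt (.set rV 2 ;; .ite rCnt rV (.set rV 1 ;; .store rC rW rV) .nop) (.set rOk 0)

/-- Tests if the current set is a minimal transversal of the first `rJ + 1` clauses. -/
def Prog.check : Prog :=
  .clear ;; (.copy rL rJ ;; .inc rL ;; .set rOk 1) ;; .scan (.set rCnt 0) .countCommon .markSole ;;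
    .forTo rE rN (.load rV rT rE ;; .load rX rC rE ;; .ite rX rV (.set rOk 0) .nop)

/-- Tests if the current option adds an element that the current set already contains. -/
def Prog.testOption : Prog :=
  .ite rZ rI (.load rP rO rJ ;; .load rX rP rI ;; .load rV rT rX) (.set rV 0)

/-- Sets the indicator of the element that the current option adds to the content of `r`. -/
def Prog.setOption (r : ℕ) : Prog :=
  .ite rZ rI (.load rP rO rJ ;; .load rX rP rI ;; .store rT rX r) .nop

/-- Follows the current option. -/
def Prog.addOption : Prog := .set rV 1 ;; .setOption rV

/-- Undoes the current option and goes on to the next one. -/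
def Prog.undo : Prog := .setOption rZ ;; .inc rI

/-- Passes to the first option of the next level. -/
def Prog.descend : Prog := .store rH rJ rI ;; .inc rJ ;; .set rI 0

/-- Tries the current option. -/
def Prog.attempt : Prog :=
  .testOption ;; .ite rZ rV (.inc rI) (.addOption ;; .check ;; .ite rZ rOk .descend .undo)

/-- Returns to the previous level. -/
def Prog.back : Prog :=
  .ite rZ rJ (.dec rJ ;; .load rI rH rJ ;; .undo) (.set rGo 0)

/-- Writes the current set. -/
def Prog.writeSet : Prog :=
  .forTo rE rN (.load rV rT rE ;; .ite rZ rV (.write rE) .nop)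

/-- Reads the length of the clause of the current level; there is none at the leaves. -/
def Prog.readLength : Prog :=
  .ite rJ rM (.load rP rO rJ ;; .load rLen rP rZ) (.set rLen 0)

/-- One step of the search. -/
def Prog.searchStep : Prog :=
  .readLength ;; .ite rLen rI .back (.ite rJ rM .attempt (.writeSet ;; .endItem ;; .inc rI))

/-- Searches the tree. -/
def Prog.search : Prog :=
  (.set rJ 0 ;; .set rI 0 ;; .set rGo 1) ;; .loop rZ rGo .searchStep

/-- Lists the minimal transversals of a 1-degenerate CNF. -/
def Prog.dualize : Prog :=
  (.load rN rZ rZ ;; .set rV 1 ;; .load rM rZ rV) ;;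
    .ite rZ rM
      (.skim ;; .ite rZ rOk (.allocate ;; .index ;; .arrange ;; .search) .nop)
      .endItem

/-! ### The memory layout -/

/-- An input with `m` clauses over the variables `0, …, n - 1`: the `k`-th clause and its address,
and the address `base` of the free memory. -/
structure Layout where
  n : ℕ
  m : ℕ
  base : ℕ
  clause : ℕ → List ℕ
  addr : ℕ → ℕ
  m_le : m ≤ n
  lt_of_mem : ∀ k < m, ∀ x ∈ clause k, x < n
  nodup : ∀ k < m, (clause k).Nodup
  addr_lt : ∀ k < m, addr k + (clause k).length < base

namespace Layout

variable (L : Layout) {k : ℕ}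

theorem length_le (hk : k < L.m) : (L.clause k).length ≤ L.n := by
  simpa using ((L.nodup k hk).subperm fun x hx =>
    List.mem_range.2 (L.lt_of_mem k hk x hx)).length_le

/-- The layout with the clauses in the order given by `f`. -/
def permute (f : Equiv.Perm ℕ) (hf : ∀ k < L.m, f k < L.m) : Layout where
  n := L.n
  m := L.m
  base := L.base
  clause k := L.clause (f k)
  addr k := L.addr (f k)
  m_le := L.m_le
  lt_of_mem k hk := L.lt_of_mem _ (hf k hk)
  nodup k hk := L.nodup _ (hf k hk)
  addr_lt k hk := L.addr_lt _ (hf k hk)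

theorem swap_lt {i j m : ℕ} (hi : i < m) (hj : j < m) (hk : k < m) : Equiv.swap i j k < m := by
  rw [Equiv.swap_apply_def]; split_ifs <;> assumption

/-- The layout with two clauses exchanged. -/
def swap {i j : ℕ} (hi : i < L.m) (hj : j < L.m) : Layout :=
  L.permute (Equiv.swap i j) fun _ => swap_lt hi hj

end Layout

/-- The memory holds the input, the addresses of the clauses in the order of the layout, the
counters `C`, the current set `T`, and the stack `H`, with the registers `rZ`, …, `rH` set
accordingly. -/
structure Stores (L : Layout) (s : State) (C : ℕ → ℕ) (T : Finset ℕ) (H : ℕ → ℕ) : Prop where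
  zero : s.reg rZ = 0
  n : s.reg rN = L.n
  m : s.reg rM = L.m
  baseO : s.reg rO = L.base
  baseC : s.reg rC = L.base + L.n
  baseT : s.reg rT = L.base + 2 * L.n
  baseH : s.reg rH = L.base + 3 * L.n
  length : ∀ k < L.m, s.mem (L.addr k) = (L.clause k).length
  element : ∀ k < L.m, ∀ i x, (L.clause k)[i]? = some x → s.mem (L.addr k + (i + 1)) = x
  address : ∀ k < L.m, s.mem (L.base + k) = L.addr k
  counter : ∀ y < L.n, s.mem (L.base + L.n + y) = C y
  current : ∀ y < L.n, s.mem (L.base + 2 * L.n + y) = if y ∈ T then 1 else 0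
  stack : ∀ k < L.m, s.mem (L.base + 3 * L.n + k) = H k
  lt : ∀ y ∈ T, y < L.n

namespace Stores

variable {L : Layout} {s s' : State} {C C' : ℕ → ℕ} {T T' : Finset ℕ} {H H' : ℕ → ℕ}
  {a r v y : ℕ}

theorem congr (h : Stores L s C T H) (hreg : ∀ r < 7, s'.reg r = s.reg r)
    (hmem : s'.mem = s.mem) : Stores L s' C T H where
  zero := (hreg _ (by decide)).trans h.zero
  n := (hreg _ (by decide)).trans h.n
  m := (hreg _ (by decide)).trans h.m
  baseO := (hreg _ (by decide)).trans h.baseO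
  baseC := (hreg _ (by decide)).trans h.baseC
  baseT := (hreg _ (by decide)).trans h.baseT
  baseH := (hreg _ (by decide)).trans h.baseH
  length := hmem ▸ h.length
  element := hmem ▸ h.element
  address := hmem ▸ h.address
  counter := hmem ▸ h.counter
  current := hmem ▸ h.current
  stack := hmem ▸ h.stack
  lt := h.lt

@[simp] theorem setReg_iff (hr : 7 ≤ r) :
    Stores L (s.setReg r v) C T H ↔ Stores L s C T H := by
  have hreg (x : ℕ) (hx : x < 7) : (s.setReg r v).reg x = s.reg x := by
    rw [State.reg_setReg, if_neg (by omega)]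
  exact ⟨fun h => h.congr (fun x hx => (hreg x hx).symm) rfl, fun h => h.congr hreg rfl⟩

theorem setReg (h : Stores L s C T H) (hr : 7 ≤ r) : Stores L (s.setReg r v) C T H :=
  (setReg_iff hr).2 h

theorem congr_counter (h : Stores L s C T H) (hC : ∀ y < L.n, C y = C' y) : Stores L s C' T H :=
  { h with counter := fun y hy => (h.counter y hy).trans (hC y hy) }

theorem setMem (h : Stores L s C T H) (ha : L.base + L.n ≤ a)
    (hC : ∀ y < L.n, (if L.base + L.n + y = a then v else C y) = C' y)
    (hT : ∀ y < L.n, (if L.base + 2 * L.n + y = a then v else if y ∈ T then 1 else 0) =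
      if y ∈ T' then 1 else 0)
    (hH : ∀ k < L.m, (if L.base + 3 * L.n + k = a then v else H k) = H' k)
    (hlt : ∀ y ∈ T', y < L.n) :
    Stores L (s.setMem a v) C' T' H' where
  zero := h.zero
  n := h.n
  m := h.m
  baseO := h.baseO
  baseC := h.baseC
  baseT := h.baseT
  baseH := h.baseH
  length k hk := by
    have := L.addr_lt k hk
    rw [State.mem_setMem, if_neg (by omega), h.length k hk]
  element k hk i x hx := by
    have := L.addr_lt k hk
    have := (List.getElem?_eq_some_iff.1 hx).1
    rw [State.mem_setMem, if_neg (by omega), h.element k hk i x hx]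
  address k hk := by
    have := L.m_le
    rw [State.mem_setMem, if_neg (by omega), h.address k hk]
  counter y hy := by rw [State.mem_setMem, h.counter y hy, hC y hy]
  current y hy := by rw [State.mem_setMem, h.current y hy, hT y hy]
  stack k hk := by rw [State.mem_setMem, h.stack k hk, hH k hk]
  lt := hlt

theorem store_counter (h : Stores L s C T H) (hy : y < L.n) (ha : a = L.base + L.n + y) :
    Stores L (s.setMem a v) (Function.update C y v) T H := by
  have := L.m_le
  refine h.setMem (by omega) (fun _ _ => ?_) (fun _ _ => ?_) (fun _ _ => ?_) h.lt
  · simp only [ha, Function.update_apply, Nat.add_left_cancel_iff]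
  all_goals rw [if_neg (by omega)]

theorem insert_current (h : Stores L s C T H) (hy : y < L.n) (ha : a = L.base + 2 * L.n + y) :
    Stores L (s.setMem a 1) C (insert y T) H := by
  have := L.m_le
  refine h.setMem (by omega) (fun _ _ => ?_) (fun _ _ => ?_) (fun _ _ => ?_) fun x hx =>
    (Finset.mem_insert.1 hx).elim (· ▸ hy) (h.lt x)
  · rw [if_neg (by omega)]
  · simp only [ha, Nat.add_left_cancel_iff, Finset.mem_insert, ite_or]
  · rw [if_neg (by omega)]

theorem erase_current (h : Stores L s C T H) (hy : y < L.n) (ha : a = L.base + 2 * L.n + y) :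
    Stores L (s.setMem a 0) C (T.erase y) H := by
  have := L.m_le
  refine h.setMem (by omega) (fun _ _ => ?_) (fun _ _ => ?_) (fun _ _ => ?_) fun x hx =>
    h.lt x (Finset.mem_of_mem_erase hx)
  · rw [if_neg (by omega)]
  · simp only [ha, Nat.add_left_cancel_iff, Finset.mem_erase, ne_eq, ite_and, ite_not]
  · rw [if_neg (by omega)]

theorem store_stack (h : Stores L s C T H) (ha : a = L.base + 3 * L.n + y) :
    Stores L (s.setMem a v) C T (Function.update H y v) := by
  refine h.setMem (by omega) (fun _ _ => ?_) (fun _ _ => ?_) (fun _ _ => ?_) h.lt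
  · rw [if_neg (by omega)]
  · rw [if_neg (by omega)]
  · simp only [ha, Function.update_apply, Nat.add_left_cancel_iff]

theorem swap_address (h : Stores L s C T H) {i j : ℕ} (hi : i < L.m) (hj : j < L.m) :
    Stores (L.swap hi hj)
      ((s.setMem (L.base + i) (L.addr j)).setMem (L.base + j) (L.addr i)) C T H := by
  have hmem (b : ℕ) (hb : b < L.base ∨ L.base + L.m ≤ b) :
      ((s.setMem (L.base + i) (L.addr j)).setMem (L.base + j) (L.addr i)).mem b = s.mem b := by
    rw [State.mem_setMem, State.mem_setMem, if_neg (by omega), if_neg (by omega)]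
  have hle (b : ℕ) (hb : L.n ≤ b) (k : ℕ) :
      L.base + b + k < L.base ∨ L.base + L.m ≤ L.base + b + k := by
    have := L.m_le
    omega
  have hswap (k : ℕ) (hk : k < L.m) : Equiv.swap i j k < L.m := Layout.swap_lt hi hj hk
  refine ⟨h.zero, h.n, h.m, h.baseO, h.baseC, h.baseT, h.baseH, fun k hk => ?_,
    fun k hk l x hx => ?_, fun k hk => ?_,
    fun y hy => (hmem _ (hle _ le_rfl y)).trans (h.counter y hy),
    fun y hy => (hmem _ (hle (2 * L.n) (by omega) y)).trans (h.current y hy),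
    fun k hk => (hmem _ (hle (3 * L.n) (by omega) k)).trans (h.stack k hk), h.lt⟩
  · have haddr := L.addr_lt _ (hswap k hk)
    exact (hmem _ (.inl (by simp only [Layout.swap, Layout.permute]; omega))).trans
      (h.length _ (hswap k hk))
  · have haddr := L.addr_lt _ (hswap k hk)
    have hlt : l < (L.clause (Equiv.swap i j k)).length := (List.getElem?_eq_some_iff.1 hx).1
    exact (hmem _ (.inl (by simp only [Layout.swap, Layout.permute]; omega))).trans
      (h.element _ (hswap k hk) l x hx)
  · have haddress := h.address k hk
    simp only [Layout.swap, Layout.permute, State.mem_setMem, Nat.add_left_cancel_iff,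
      Equiv.swap_apply_def] at haddress ⊢
    grind

theorem load_address (h : Stores L s C T H) {k : ℕ} (hk : k < L.m) :
    s.mem (s.reg rO + k) = L.addr k :=
  h.baseO ▸ h.address k hk

theorem load_counter (h : Stores L s C T H) (hy : y < L.n) : s.mem (s.reg rC + y) = C y :=
  h.baseC ▸ h.counter y hy

theorem load_current (h : Stores L s C T H) (hy : y < L.n) :
    s.mem (s.reg rT + y) = if y ∈ T then 1 else 0 :=
  h.baseT ▸ h.current y hy

theorem load_stack (h : Stores L s C T H) {k : ℕ} (hk : k < L.m) :
    s.mem (s.reg rH + k) = H k :=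
  h.baseH ▸ h.stack k hk

end Stores

/-! ### Scanning the clauses -/

/-- The truth of `A` does not depend on the content of the registers in `rs`. -/
def Ignores (A : State → Prop) (rs : List ℕ) : Prop :=
  ∀ r ∈ rs, ∀ v s, A s → A (s.setReg r v)

section Scan

variable {L : Layout} {pre body post : Prog} {s : State} {k K cpre cbody cpost : ℕ}

theorem HaltsWith.scanClause (hk : k < L.m) (B : List ℕ → State → Prop)
    (hfree : ∀ r ∈ [rP, rLen, rE], body.changes r = false)
    (hB : ∀ l s, B l s → ∃ C T H, Stores L s C T H) (hign : ∀ l, Ignores (B l) [rP, rE, rX])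
    (hP : s.reg rP = L.addr k) (hLen : s.reg rLen = (L.clause k).length) (hnil : B [] s)
    (hbody : ∀ l x s, l ++ [x] <+: L.clause k → B l s → s.reg rX = x →
      HaltsWith body s cbody [] (B (l ++ [x]))) :
    HaltsWith (.scanClause body) s (L.n * (cbody + 4) + 2) [] (B (L.clause k)) := by
  simp only [List.forall_mem_cons, List.not_mem_nil, IsEmpty.forall_iff,
    implies_true, and_true] at hfree
  obtain ⟨hfreeP, hfreeLen, hfreeE⟩ := hfree
  simp only [Ignores, List.forall_mem_cons, List.not_mem_nil, IsEmpty.forall_iff,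
    implies_true, and_true] at hign
  refine (HaltsWith.forTo (c := cbody + 2)
    (I := fun i s => B ((L.clause k).take i) s ∧ s.reg rP = L.addr k + i) (by decide)
    (by simp [hfreeE]) (by simp [hfreeLen]) hLen
    ⟨(hign _).2.1 _ _ hnil, by simpa using hP⟩ fun i hi s₁ ⟨hB₁, hP₁⟩ _ _ => ?_).mono
    (Nat.add_le_add_right (Nat.mul_le_mul_right _ (L.length_le hk)) 2) fun s' h => by
      simpa using h.1
  obtain ⟨C, T, H, hs⟩ := hB _ _ hB₁
  have hx := List.getElem?_eq_getElem hi
  refine (HaltsWith.block_seq (p := .inc rP) rfl rfl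
    (HaltsWith.block_seq (p := .load rX rP rZ) rfl rfl ?_)).mono
    (show 1 + (1 + cbody) ≤ cbody + 2 by omega) fun _ => id
  have htake := List.take_succ_eq_append_getElem hi
  refine (hbody _ _ _ (htake ▸ List.take_prefix _ _) ((hign _).2.2 _ _ ((hign _).1 _ _ hB₁))
    ?_).frame.mono le_rfl fun s₂ ⟨hB₂, hframe⟩ => ⟨?_, ?_⟩
  · simpa [hP₁, hs.zero, add_assoc] using hs.element k hk i _ hx
  · exact htake ▸ (hign _).2.1 _ _ hB₂
  · simp [hframe rP hfreeP, hP₁, add_assoc]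

/-- In the loop invariants, `A q` is what holds after the first `q` clauses, and `B q l` after the
part `l` of the clause `q`. -/
theorem HaltsWith.scan (A : ℕ → State → Prop) (B : ℕ → List ℕ → State → Prop)
    (hfree : ∀ p ∈ [pre, body, post], ∀ r ∈ [rP, rLen, rQ, rE, rL], p.changes r = false)
    (hA : ∀ q s, A q s → ∃ C T H, Stores L s C T H)
    (hB : ∀ q l s, B q l s → ∃ C T H, Stores L s C T H)
    (hignA : ∀ q, Ignores (A q) [rP, rLen, rQ, rE, rX])
    (hignB : ∀ q l, Ignores (B q l) [rP, rE, rX])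
    (hKm : K ≤ L.m) (hK : s.reg rL = K) (hzero : A 0 s)
    (hpre : ∀ q < K, ∀ s, A q s → HaltsWith pre s cpre [] (B q []))
    (hbody : ∀ q < K, ∀ l x s, l ++ [x] <+: L.clause q → B q l s → s.reg rQ = q →
      s.reg rX = x → HaltsWith body s cbody [] (B q (l ++ [x])))
    (hpost : ∀ q < K, ∀ s, B q (L.clause q) s → HaltsWith post s cpost [] (A (q + 1))) :
    HaltsWith (.scan pre body post) s (K * (L.n * (cbody + 4) + cpre + cpost + 6) + 2) []
      (A K) := by
  simp only [List.forall_mem_cons, List.not_mem_nil, IsEmpty.forall_iff,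
    implies_true, and_true] at hfree
  simp only [Ignores, List.forall_mem_cons, List.not_mem_nil, IsEmpty.forall_iff,
    implies_true, and_true] at hignA hignB
  obtain ⟨⟨hpreP, hpreLen, hpreQ, -, hpreL⟩, ⟨hbodyP, hbodyLen, hbodyQ, hbodyE, hbodyL⟩,
    ⟨-, -, hpostQ, -, hpostL⟩⟩ := hfree
  refine HaltsWith.forTo (c := L.n * (cbody + 4) + cpre + cpost + 4) (I := A) (by decide)
    (by simp [Prog.scanClause, hpreQ, hbodyQ, hpostQ])
    (by simp [Prog.scanClause, hpreL, hbodyL, hpostL]) hK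
    ((hignA _).2.2.1 _ _ hzero) fun q hq s₁ hA₁ hQ₁ _ => ?_
  obtain ⟨C, T, H, hs⟩ := hA _ _ hA₁
  have haddr : s₁.mem (s₁.reg rO + s₁.reg rQ) = L.addr q := by
    rw [hs.baseO, hQ₁, hs.address q (hq.trans_le hKm)]
  refine (HaltsWith.block_seq (p := .load rP rO rQ) rfl rfl
    (HaltsWith.block_seq (p := .load rLen rP rZ) (T := cpre + (L.n * (cbody + 4) + 2 + cpost))
      rfl rfl ((hpre q hq _ ((hignA _).2.1 _ _ ((hignA _).1 _ _ hA₁))).seq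
      fun s₂ hB₂ hframe₂ => ?_))).mono (by simp only [Prog.cost]; omega) fun _ => id
  have hQ₂ : s₂.reg rQ = q := by rw [hframe₂ _ hpreQ]; simpa using hQ₁
  refine (HaltsWith.scanClause (hq.trans_le hKm) (fun l s => B q l s ∧ s.reg rQ = q)
    (by simp [*]) (fun l s h => hB q l s h.1) (fun l => ?_) ?_ ?_ ⟨hB₂, hQ₂⟩
    fun l x s₃ hl ⟨hB₃, hQ₃⟩ hx => ?_).seq fun s₄ h₄ _ =>
      (hpost q hq s₄ h₄.1).mono le_rfl fun s₅ h₅ => (hignA _).2.2.1 _ _ h₅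
  · simpa [Ignores] using ⟨fun v s h hQ => ⟨(hignB q l).1 v s h, hQ⟩,
      fun v s h hQ => ⟨(hignB q l).2.1 v s h, hQ⟩, fun v s h hQ => ⟨(hignB q l).2.2 v s h, hQ⟩⟩
  · simp [hframe₂ _ hpreP, haddr]
  · simpa [hframe₂ _ hpreLen, haddr, hs.zero] using hs.length q (hq.trans_le hKm)
  · exact (hbody q hq l x s₃ hl hB₃ hQ₃ hx).frame.mono le_rfl fun s₄ ⟨hB₄, hframe₄⟩ =>
      ⟨hB₄, (hframe₄ _ hbodyQ).trans hQ₃⟩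

end Scan

/-! ### The arrangement of the clauses -/

section Arrange

variable {L : Layout} {s : State} {C : ℕ → ℕ} {T : Finset ℕ} {H : ℕ → ℕ} {K : ℕ}

theorem HaltsWith.clear (h : Stores L s C T H) :
    HaltsWith .clear s (L.n * 3 + 2) [] fun s' => Stores L s' (fun _ => 0) T H := by
  refine (HaltsWith.forTo (c := 1)
    (I := fun y s => Stores L s (fun x => if x < y then 0 else C x) T H)
    (by decide) rfl rfl h.n (by simpa using h) fun y hy s hs hE _ => ?_).mono le_rfl
    fun s' hs' => hs'.congr_counter fun y hy => if_pos hy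
  refine HaltsWith.block rfl rfl le_rfl (Stores.setReg ?_ (by decide))
  refine (hs.store_counter hy (by rw [hs.baseC, hE])).congr_counter fun x _ => ?_
  rw [Function.update_apply, hs.zero]
  grind

theorem HaltsWith.count (h : Stores L s (fun _ => 0) T H) (hKm : K ≤ L.m) (hK : s.reg rL = K) :
    HaltsWith .count s (K * (L.n * 7 + 8) + 2) [] fun s' =>
      Stores L s' (fun x => ((List.range K).flatMap L.clause).count x) T H := by
  refine HaltsWith.scan (cpre := 1) (cbody := 3) (cpost := 1)
    (fun q s => Stores L s (fun x => ((List.range q).flatMap L.clause).count x) T H)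
    (fun q l s => Stores L s (fun x => ((List.range q).flatMap L.clause ++ l).count x) T H)
    (by decide) (fun _ _ h => ⟨_, _, _, h⟩) (fun _ _ _ h => ⟨_, _, _, h⟩) (by simp [Ignores])
    (by simp [Ignores]) hKm hK (by simpa using h) (fun q _ s hs => ?_)
    (fun q hq l x s hl hs _ hx => ?_) fun q _ s hs => ?_
  · exact .block rfl rfl le_rfl (Stores.setReg (by simpa using hs) (by decide))
  · have hxn : x < L.n := L.lt_of_mem q (hq.trans_le hKm) x (hl.subset (by simp))
    refine .block rfl rfl le_rfl ?_
    simp only [Prog.eval, hx, hs.load_counter hxn, State.reg_setReg, Nat.reduceEqDiff, if_true,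
      if_false]
    refine (((hs.setReg (by decide)).setReg (by decide)).store_counter hxn
      (by rw [hs.baseC])).congr_counter fun y _ => ?_
    rw [Function.update_apply, ← List.append_assoc, List.count_append (l₂ := [x]),
      List.count_singleton]
    grind
  · refine .block rfl rfl le_rfl (Stores.setReg ?_ (by decide))
    simpa [List.range_succ] using hs

theorem HaltsWith.find (h : Stores L s C T H) (hKm : K ≤ L.m) (hK : s.reg rL = K)
    (hex : ∃ q < K, ∃ x ∈ L.clause q, C x < 2) :
    HaltsWith .find s (K * (L.n * 8 + 8) + 3) [] fun s' =>
      Stores L s' C T H ∧ s'.reg rF < K ∧ ∃ x ∈ L.clause (s'.reg rF), C x < 2 := by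
  set Found : State → Prop := fun s => s.reg rF < K ∧ ∃ x ∈ L.clause (s.reg rF), C x < 2
  have hscan := HaltsWith.scan (pre := .nop) (post := .nop)
    (body := .load rV rC rX ;; .set rW 2 ;; .ite rV rW (.copy rF rQ) .nop)
    (s := s.setReg rF 0) (K := K) (cpre := 1) (cbody := 4) (cpost := 1)
    (fun q s => Stores L s C T H ∧ (Found s ∨ ∀ r < q, ∀ x ∈ L.clause r, 2 ≤ C x))
    (fun q l s => Stores L s C T H ∧
      (Found s ∨ (∀ r < q, ∀ x ∈ L.clause r, 2 ≤ C x) ∧ ∀ x ∈ l, 2 ≤ C x))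
    (by decide) (fun _ _ h => ⟨_, _, _, h.1⟩) (fun _ _ _ h => ⟨_, _, _, h.1⟩)
    (by simp +contextual [Ignores, Found]) (by simp +contextual [Ignores, Found]) hKm
    (by simpa using hK) (by simpa using h) (fun q _ s hs => ?_)
    (fun q hq l x s hl ⟨hs, hfound⟩ hQ hx => ?_) fun q _ s ⟨hs, hfound⟩ => ?_
  · refine (hscan.block_seq (p := .set rF 0) rfl rfl).mono
      (by simp only [Prog.cost]; ring_nf; rfl) fun s' ⟨hs', hfound⟩ => ⟨hs', ?_⟩
    obtain ⟨q, hq, x, hx, hCx⟩ := hex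
    exact hfound.resolve_right fun h => (h q hq x hx).not_gt hCx
  · exact .block rfl rfl le_rfl (by simpa [Prog.nop, Found] using hs)
  · have hxn : x < L.n := L.lt_of_mem q (hq.trans_le hKm) x (hl.subset (by simp))
    refine .block rfl rfl le_rfl ?_
    simp only [Prog.eval, hx, hs.load_counter hxn, State.reg_setReg, Nat.reduceEqDiff, if_true,
      if_false]
    split_ifs with hCx
    · exact ⟨by simpa using hs, .inl ⟨by simpa [hQ] using hq, x,
        by simpa [hQ] using hl.subset (by simp), hCx⟩⟩
    · refine ⟨by simpa [Prog.nop] using hs, hfound.imp (by simp [Prog.nop, Found]) ?_⟩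
      simp only [List.mem_append, List.mem_singleton]
      grind
  · refine .block rfl rfl le_rfl ⟨by simpa [Prog.nop] using hs, ?_⟩
    refine hfound.imp (by simp [Prog.nop, Found]) fun ⟨hlt, hq⟩ r hr => ?_
    obtain hr | rfl := Nat.lt_succ_iff_lt_or_eq.1 hr
    exacts [hlt r hr, hq]

theorem count_flatMap_range_lt_two_iff {c : ℕ → List ℕ} (hc : ∀ q < K, (c q).Nodup) {i x : ℕ}
    (hi : i < K) (hx : x ∈ c i) :
    ((List.range K).flatMap c).count x < 2 ↔ ∀ r < K, x ∈ c r → r = i := by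
  have hcount : ((List.range K).flatMap c).count x =
      ((Finset.range K).filter fun r => x ∈ c r).card := by
    rw [List.count_flatMap, Finset.card_filter]
    refine (Finset.sum_congr rfl fun r hr => ?_ : ∑ r ∈ Finset.range K, (c r).count x = _)
    exact (hc r (Finset.mem_range.1 hr)).count
  rw [hcount, Nat.lt_succ_iff, Finset.card_le_one_iff]
  simp only [Finset.mem_filter, Finset.mem_range]
  exact ⟨fun h r hr hxr => h ⟨hr, hxr⟩ ⟨hi, hx⟩,
    fun h r r' hr hr' => (h r hr.1 hr.2).trans (h r' hr'.1 hr'.2).symm⟩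

namespace Layout

/-- Every nonempty family of clauses has a member with a variable of its own. -/
def HasOwn (L : Layout) : Prop :=
  ∀ S : Finset ℕ, S.Nonempty → (∀ k ∈ S, k < L.m) →
    ∃ k ∈ S, ∃ x ∈ L.clause k, ∀ r ∈ S, x ∈ L.clause r → r = k

theorem HasOwn.permute (h : L.HasOwn) (f : Equiv.Perm ℕ) (hf : ∀ k < L.m, f k < L.m) :
    (L.permute f hf).HasOwn := by
  intro S hS hlt
  obtain ⟨k, hk, x, hx, hown⟩ := h (S.map f.toEmbedding) hS.map (by
    simpa [-Finset.mem_map_equiv] using fun k hk => hf k (hlt k hk))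
  obtain ⟨k, hkS, rfl⟩ := Finset.mem_map.1 hk
  exact ⟨k, hkS, x, hx, fun r hr hxr => f.injective
    (hown _ (Finset.mem_map_of_mem _ hr) hxr)⟩

/-- Every clause from the `K`-th one on contains a variable that does not occur in the clauses
before it. -/
def FreshFrom (L : Layout) (K : ℕ) : Prop :=
  ∀ k < L.m, K ≤ k → ∃ x ∈ L.clause k, ∀ q < k, x ∉ L.clause q

theorem FreshFrom.swap (h : L.FreshFrom (K + 1)) {i x : ℕ} (hi : i < L.m) (hK : K < L.m)
    (hiK : i ≤ K) (hx : x ∈ L.clause i) (hown : ∀ r < K + 1, x ∈ L.clause r → r = i) :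
    (L.swap hi hK).FreshFrom K := by
  intro k hk hKk
  obtain rfl | hne := eq_or_ne k K
  · refine ⟨x, by simpa [Layout.swap, Layout.permute] using hx, fun q hq hxq => ?_⟩
    have := hown (Equiv.swap i k q) (swap_lt (by omega) (by omega) (by omega)) hxq
    rw [Equiv.swap_apply_eq_iff, Equiv.swap_apply_left] at this
    omega
  · obtain ⟨y, hy, hfresh⟩ := h k hk (by omega)
    refine ⟨y, ?_, fun q hq => hfresh _ (swap_lt (by omega) (by omega) hq)⟩
    change y ∈ L.clause (Equiv.swap i K k)
    rwa [Equiv.swap_apply_of_ne_of_ne (by omega) hne]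

end Layout

theorem HaltsWith.moveLast (h : Stores L s C T H) (hK : s.reg rL = K + 1) (hKm : K < L.m)
    (hF : s.reg rF < L.m) : HaltsWith .moveLast s 5 [] fun s' =>
      s'.reg rL = K ∧ Stores (L.swap hF hKm) s' C T H := by
  refine .block rfl rfl le_rfl ?_
  simp only [Prog.moveLast, Prog.eval, hK, State.reg_setReg, State.mem_setReg, State.reg_setMem,
    Nat.reduceEqDiff, if_true, if_false, Nat.add_sub_cancel, h.baseO, true_and]
  rw [← h.baseO, h.load_address hF, h.load_address hKm, h.baseO]
  exact Stores.swap_address (by simpa using h) hF hKm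

theorem HaltsWith.arrangeStep (hown : L.HasOwn) (h : Stores L s C T H) (hK : s.reg rL = K + 1)
    (hKm : K < L.m) (hfresh : L.FreshFrom (K + 1)) :
    HaltsWith (.clear ;; .count ;; .find ;; .moveLast) s
      (L.m * (15 * L.n + 16) + 3 * L.n + 12) [] fun s' =>
      s'.reg rL = K ∧ ∃ (i : ℕ) (hi : i < L.m) (C : ℕ → ℕ),
        Stores (L.swap hi hKm) s' C T H ∧ (L.swap hi hKm).FreshFrom K := by
  have hnodup (q : ℕ) (hq : q < K + 1) : (L.clause q).Nodup := L.nodup q (by omega)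
  have hex : ∃ q < K + 1, ∃ x ∈ L.clause q,
      ((List.range (K + 1)).flatMap L.clause).count x < 2 := by
    obtain ⟨q, hq, x, hx, hq_own⟩ := hown (Finset.range (K + 1)) (by simp)
      fun k hk => (Finset.mem_range.1 hk).trans_le hKm
    simp only [Finset.mem_range] at hq hq_own
    exact ⟨q, hq, x, hx, (count_flatMap_range_lt_two_iff hnodup hq hx).2 hq_own⟩
  refine ((HaltsWith.clear h).seq fun s₁ h₁ hframe₁ => (HaltsWith.count h₁ (K := K + 1) hKm
    (by rw [hframe₁ _ rfl, hK])).seq fun s₂ h₂ hframe₂ => (HaltsWith.find h₂ (K := K + 1) hKm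
    (by rw [hframe₂ _ rfl, hframe₁ _ rfl, hK]) hex).seq fun s₃ ⟨h₃, hF, y, hy, hCy⟩ hframe₃ =>
    (HaltsWith.moveLast h₃ (by rw [hframe₃ _ rfl, hframe₂ _ rfl, hframe₁ _ rfl, hK]) hKm
      (hF.trans_le hKm)).mono le_rfl fun s₄ ⟨hL₄, h₄⟩ => ⟨hL₄, _, _, _, h₄,
        hfresh.swap _ hKm (Nat.lt_succ_iff.1 hF) hy
          ((count_flatMap_range_lt_two_iff hnodup hF hy).1 hCy)⟩).mono ?_ fun _ => id
  calc L.n * 3 + 2 + ((K + 1) * (L.n * 7 + 8) + 2 + ((K + 1) * (L.n * 8 + 8) + 3 + 5))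
    _ = (K + 1) * (15 * L.n + 16) + 3 * L.n + 12 := by ring
    _ ≤ L.m * (15 * L.n + 16) + 3 * L.n + 12 := by gcongr; exact hKm

theorem HaltsWith.arrange (hown : L.HasOwn) (h : Stores L s C T H) :
    HaltsWith .arrange s (L.m * (L.m * (15 * L.n + 16) + 3 * L.n + 14) + 3) [] fun s' =>
      ∃ f hf C, Stores (L.permute f hf) s' C T H ∧ (L.permute f hf).FreshFrom 0 := by
  have hloop := HaltsWith.forTo (i := rK) (l := rM) (p := .clear ;; .count ;; .find ;; .moveLast)
    (s := s.setReg rL (s.reg rM)) (c := L.m * (15 * L.n + 16) + 3 * L.n + 12)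
    (I := fun i s => s.reg rL = L.m - i ∧ ∃ f hf C, Stores (L.permute f hf) s C T H ∧
      (L.permute f hf).FreshFrom (L.m - i))
    (by decide) rfl rfl h.m ?_ fun i hi s₁ ⟨hL, f, hf, C₁, hs₁, hfresh⟩ _ _ => ?_
  · refine (hloop.block_seq (p := .copy rL rM) rfl rfl).mono
      (by simp only [Prog.cost]; ring_nf; rfl) fun s' ⟨_, hs'⟩ => by simpa using hs'
  · refine ⟨by simp [h.m], 1, fun _ => id, C, ?_, fun k hk hmk => absurd hk hmk.not_gt⟩
    exact h.setReg (by decide) |>.setReg (by decide)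
  · have hlt : L.m - (i + 1) < L.m := by omega
    rw [show L.m - i = L.m - (i + 1) + 1 by omega] at hL hfresh
    exact (HaltsWith.arrangeStep (hown.permute f hf) hs₁ hL hlt hfresh).mono le_rfl
      fun s₂ ⟨hL₂, q, hq, C₂, hs₂, hfresh₂⟩ => ⟨by simpa using hL₂, f * Equiv.swap q _,
        fun k hk => hf _ (Layout.swap_lt hq hlt hk), C₂, hs₂.setReg (by decide), hfresh₂⟩

end Arrange

/-! ### The test for minimal transversals -/

section Check

variable {c : ℕ → List ℕ} {T : Finset ℕ} {q w y : ℕ}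

/-- In one of the first `q` clauses, `y` is the only element of `T`. -/
def IsPrivate (c : ℕ → List ℕ) (T : Finset ℕ) (q y : ℕ) : Prop :=
  ∃ r < q, (c r).filter (· ∈ T) = [y]

theorem isPrivate_succ :
    IsPrivate c T (q + 1) y ↔ IsPrivate c T q y ∨ (c q).filter (· ∈ T) = [y] := by
  simp only [IsPrivate, Nat.lt_succ_iff_lt_or_eq, or_and_right, exists_or, exists_eq_left]

theorem filter_eq_singleton_iff {l : List ℕ} (hl : l.Nodup) (hT : Meets l T) :
    l.filter (· ∈ T) = [y] ↔ ¬ Meets l (T.erase y) := by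
  obtain ⟨x, hx, hxT⟩ := hT
  have hxf : x ∈ l.filter (· ∈ T) := by simp [hx, hxT]
  constructor
  · rintro hy ⟨z, hz, hzT⟩
    obtain ⟨hzy, hzT⟩ := Finset.mem_erase.1 hzT
    have hzf : z ∈ l.filter (· ∈ T) := by simp [hz, hzT]
    exact hzy (by simpa [hy] using hzf)
  · intro hy
    have heq (z : ℕ) (hz : z ∈ l.filter (· ∈ T)) : z = y := by
      by_contra hne
      rw [List.mem_filter, decide_eq_true_iff] at hz
      exact hy ⟨z, hz.1, Finset.mem_erase.2 ⟨hne, hz.2⟩⟩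
    have hreplicate := List.eq_replicate_of_mem heq
    have hle := List.nodup_replicate.1 (hreplicate ▸ hl.filter _)
    rw [hreplicate, le_antisymm hle (List.length_pos_of_mem hxf), List.replicate_one]

theorem minimal_meetsFirst_iff (hc : ∀ r < q, (c r).Nodup) :
    Minimal (MeetsFirst c q) T ↔ MeetsFirst c q T ∧ ∀ y ∈ T, IsPrivate c T q y := by
  rw [Finset.minimal_iff_forall_erase fun _ _ h hst => monotone_meetsFirst c q hst h]
  refine and_congr_right fun hT => forall₂_congr fun y _ => ?_
  simp only [MeetsFirst, IsPrivate, not_forall, exists_prop]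
  exact exists_congr fun r => and_congr_right fun hr =>
    (filter_eq_singleton_iff (hc r hr) (hT r hr)).symm

open Classical in
/-- The marks that `Prog.check` leaves after the first `q` clauses: `1` for the elements of `T` that
are private to one of them. -/
noncomputable def marks (c : ℕ → List ℕ) (T : Finset ℕ) (q y : ℕ) : ℕ :=
  if IsPrivate c T q y then 1 else 0

theorem marks_succ_of_eq_singleton (hw : (c q).filter (· ∈ T) = [w]) :
    marks c T (q + 1) = Function.update (marks c T q) w 1 := by
  funext y
  have hiff := isPrivate_succ (c := c) (T := T) (q := q) (y := y)
  simp only [hw, List.cons.injEq, and_true] at hiff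
  simp only [marks, Function.update_apply]
  grind

theorem marks_succ_of_length_ne_one (h : ((c q).filter (· ∈ T)).length ≠ 1) :
    marks c T (q + 1) = marks c T q := by
  funext y
  have hne : (c q).filter (· ∈ T) ≠ [y] := fun heq => h (by rw [heq]; rfl)
  classical exact if_congr (isPrivate_succ.trans (or_iff_left hne)) rfl rfl

variable {L : Layout} {s : State} {C H : ℕ → ℕ} {j : ℕ}

/-- The invariant of `Prog.check` after the first `q` clauses. -/
def Checked (L : Layout) (T : Finset ℕ) (H : ℕ → ℕ) (q : ℕ) (s : State) : Prop :=
  Stores L s (marks L.clause T q) T H ∧ (0 < s.reg rOk ↔ MeetsFirst L.clause q T)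

/-- The invariant of `Prog.check` after the part `l` of the clause `q`. -/
def CheckedPart (L : Layout) (T : Finset ℕ) (H : ℕ → ℕ) (q : ℕ) (l : List ℕ) (s : State) : Prop :=
  Checked L T H q s ∧ s.reg rCnt = (l.filter (· ∈ T)).length ∧
    (0 < s.reg rCnt → s.reg rW ∈ l.filter (· ∈ T))

theorem HaltsWith.countCommon {l : List ℕ} {x : ℕ} (h : CheckedPart L T H q l s) (hx : x < L.n)
    (hX : s.reg rX = x) :
    HaltsWith .countCommon s 4 [] (CheckedPart L T H q (l ++ [x])) := by
  obtain ⟨⟨hs, hOk⟩, hCnt, hW⟩ := h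
  refine .block rfl rfl le_rfl ?_
  simp only [Prog.countCommon, Prog.eval, Prog.nop, hX, hs.load_current hx, hs.zero,
    State.reg_setReg, Nat.reduceEqDiff, OfNat.zero_ne_ofNat, if_true, if_false]
  by_cases hxT : x ∈ T
  · simpa [CheckedPart, Checked, hxT, hX, hCnt] using ⟨hs, hOk⟩
  · simpa [CheckedPart, Checked, hxT, hCnt] using ⟨⟨hs, hOk⟩, by simpa [hCnt] using hW⟩

theorem HaltsWith.markSole (h : CheckedPart L T H q (L.clause q) s) (hq : q < L.m) :
    HaltsWith .markSole s 5 [] (Checked L T H (q + 1)) := by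
  obtain ⟨⟨hs, hOk⟩, hCnt, hW⟩ := h
  refine .block rfl rfl le_rfl ?_
  simp only [Prog.markSole, Prog.eval, Prog.nop, hs.zero, State.reg_setReg, Nat.reduceEqDiff,
    if_true, if_false]
  have hmeets : 0 < s.reg rCnt ↔ Meets (L.clause q) T := by
    simp [hCnt, List.length_pos_iff_exists_mem, Meets]
  have hsucc : MeetsFirst L.clause (q + 1) T ↔ 0 < s.reg rOk ∧ 0 < s.reg rCnt := by
    rw [meetsFirst_succ, hOk, hmeets]
    rfl
  rw [Checked, hsucc]
  split_ifs with hpos hlt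
  · obtain ⟨w, hw⟩ := List.length_eq_one_iff.1
      (show ((L.clause q).filter (· ∈ T)).length = 1 by omega)
    have hWw : s.reg rW = w := by simpa [hw] using hW hpos
    have hwn : w < L.n := L.lt_of_mem q hq w (List.mem_filter.1 (hw ▸ List.mem_singleton_self w)).1
    rw [marks_succ_of_eq_singleton hw]
    refine ⟨Stores.store_counter (by simpa using hs) hwn (by simp [hs.baseC, hWw]), ?_⟩
    simp [hpos]
  · rw [marks_succ_of_length_ne_one (by omega)]
    simpa [hpos] using hs
  · rw [marks_succ_of_length_ne_one (by omega)]
    simpa [hpos] using hs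

theorem HaltsWith.checkClauses (h : Checked L T H 0 s) (hqm : q ≤ L.m) (hL : s.reg rL = q) :
    HaltsWith (.scan (.set rCnt 0) .countCommon .markSole) s (q * (L.n * 8 + 12) + 2) []
      (Checked L T H q) := by
  refine HaltsWith.scan (cpre := 1) (cbody := 4) (cpost := 5) (Checked L T H) (CheckedPart L T H)
    (by decide) (fun _ _ h => ⟨_, _, _, h.1⟩) (fun _ _ _ h => ⟨_, _, _, h.1.1⟩)
    (by simp +contextual [Ignores, Checked]) (by simp +contextual [Ignores, CheckedPart, Checked])
    hqm hL h (fun r _ s hs => ?_)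
    (fun r hr l x s hl hs _ hX =>
      HaltsWith.countCommon hs (L.lt_of_mem r (hr.trans_le hqm) x (hl.subset (by simp))) hX)
    fun r hr s hs => HaltsWith.markSole hs (hr.trans_le hqm)
  exact .block rfl rfl le_rfl (by simpa [CheckedPart, Checked] using hs)

theorem HaltsWith.checkElements (h : Checked L T H q s) (hqm : q ≤ L.m) :
    HaltsWith (.forTo rE rN (.load rV rT rE ;; .load rX rC rE ;; .ite rX rV (.set rOk 0) .nop)) s
      (L.n * 6 + 2) [] fun s' => (∃ C, Stores L s' C T H) ∧
        (0 < s'.reg rOk ↔ Minimal (MeetsFirst L.clause q) T) := by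
  rw [minimal_meetsFirst_iff fun r hr => L.nodup r (hr.trans_le hqm)]
  refine (HaltsWith.forTo (c := 4) (I := fun y s => Stores L s (marks L.clause T q) T H ∧
    (0 < s.reg rOk ↔ MeetsFirst L.clause q T ∧ ∀ x < y, x ∈ T → IsPrivate L.clause T q x))
    (by decide) rfl rfl h.1.n (by simpa [Checked] using h)
    fun y hy s₁ ⟨h₁, hOk₁⟩ hE _ => ?_).mono le_rfl fun s' ⟨h', hOk'⟩ =>
      ⟨⟨_, h'⟩, hOk'.trans (and_congr_right fun _ => forall_congr' fun x =>
        ⟨fun hx hxT => hx (h'.lt x hxT) hxT, fun hx _ => hx⟩)⟩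
  refine .block rfl rfl le_rfl ?_
  simp only [Prog.eval, Prog.nop, hE, State.reg_setReg, State.mem_setReg, Nat.reduceEqDiff,
    if_true, if_false, h₁.load_current hy, h₁.load_counter hy, Nat.forall_lt_succ_right]
  by_cases hfail : y ∈ T ∧ ¬ IsPrivate L.clause T q y
  · simpa [marks, hfail] using h₁
  · rw [not_and_not_right] at hfail
    have hle : ¬ marks L.clause T q y < if y ∈ T then 1 else 0 := by
      unfold marks; grind
    rw [if_neg hle, and_iff_left_of_imp fun _ => hfail]
    simpa using ⟨h₁, hOk₁⟩

theorem HaltsWith.check (h : Stores L s C T H) (hJ : s.reg rJ = j) (hj : j < L.m) :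
    HaltsWith .check s ((j + 1) * (L.n * 8 + 12) + 9 * L.n + 9) [] fun s' =>
      (∃ C, Stores L s' C T H) ∧ (0 < s'.reg rOk ↔ Minimal (MeetsFirst L.clause (j + 1)) T) := by
  refine ((HaltsWith.clear h).seq fun s₁ h₁ hframe₁ => HaltsWith.block_seq
    (p := .copy rL rJ ;; .inc rL ;; .set rOk 1) rfl rfl
    ((HaltsWith.checkClauses (q := j + 1) ⟨?_, ?_⟩ hj ?_).seq fun s₂ h₂ _ =>
      HaltsWith.checkElements h₂ hj)).mono (by simp only [Prog.cost]; omega) fun _ => id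
  · have hmarks : marks L.clause T 0 = fun _ => 0 := funext fun y => by simp [marks, IsPrivate]
    simpa [hmarks] using h₁
  · simp [MeetsFirst]
  · simp [hframe₁ rJ rfl, hJ]

end Check

/-! ### The steps of the search -/

section Steps

variable {L : Layout} {s : State} {C h : ℕ → ℕ} {T : Finset ℕ} {H : ℕ → ℕ} {o : Option ℕ}
  {i i' j x : ℕ}

theorem getElem?_options_eq_none : (options (L.clause j))[i]? = some none ↔ i = 0 := by
  cases i <;> simp [options]

theorem getElem?_options_eq_some :
    (options (L.clause j))[i]? = some (some x) ↔ ∃ k, i = k + 1 ∧ (L.clause j)[k]? = some x := by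
  cases i <;> simp [options]

theorem Stores.load_option (hs : Stores L s C T H) (hj : j < L.m)
    (hx : (options (L.clause j))[i]? = some (some x)) :
    0 < i ∧ s.mem (L.addr j + i) = x ∧ x < L.n := by
  obtain ⟨k, rfl, hk⟩ := getElem?_options_eq_some.1 hx
  exact ⟨k.succ_pos, hs.element j hj k x hk, L.lt_of_mem j hj x (List.mem_of_getElem? hk)⟩

/-- The search is at the node `T` of the level `j`, about to try the `i`-th option; `h` is the stack
of the options that led to the node. -/
def AtNode (L : Layout) (j : ℕ) (T : Finset ℕ) (i : ℕ) (h : ℕ → ℕ) (s : State) : Prop :=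
  (∃ C H, Stores L s C T H ∧ ∀ k < j, H k = h k) ∧ s.reg rJ = j ∧ s.reg rI = i ∧ s.reg rGo = 1

theorem AtNode.zero (hs : AtNode L j T i h s) : s.reg rZ = 0 := by
  obtain ⟨⟨C, H, hs, -⟩, -⟩ := hs
  exact hs.zero

theorem AtNode.m (hs : AtNode L j T i h s) : s.reg rM = L.m := by
  obtain ⟨⟨C, H, hs, -⟩, -⟩ := hs
  exact hs.m

theorem AtNode.zero_lt_go (hs : AtNode L j T i h s) : s.reg rZ < s.reg rGo := by
  simp [hs.zero, hs.2.2.2]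

/-- The number of the options of a level that add an element; it is zero at the leaves. -/
def Layout.candidates (L : Layout) (j : ℕ) : ℕ :=
  if j < L.m then (L.clause j).length else 0

theorem HaltsWith.readLength (hs : AtNode L j T i h s) :
    HaltsWith .readLength s 3 [] fun s' =>
      AtNode L j T i h s' ∧ s'.reg rLen = L.candidates j := by
  obtain ⟨⟨C, H, hs, hH⟩, hJ, hI, hGo⟩ := hs
  refine .block rfl rfl le_rfl ?_
  by_cases hj : j < L.m
  · simpa [AtNode, Prog.eval, Prog.readLength, Layout.candidates, hJ, hI, hGo, hs.m, hs.zero, hj,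
      hs.load_address hj, hs.length j hj] using ⟨C, H, hs, hH⟩
  · simpa [AtNode, Prog.eval, Prog.readLength, Layout.candidates, hJ, hI, hGo, hs.m, hj] using
      ⟨C, H, hs, hH⟩

theorem HaltsWith.testOption (hs : AtNode L j T i h s) (hj : j < L.m)
    (ho : (options (L.clause j))[i]? = some o) :
    HaltsWith .testOption s 4 [] fun s' =>
      AtNode L j T i h s' ∧ (0 < s'.reg rV ↔ ∃ x ∈ o, x ∈ T) := by
  obtain ⟨⟨C, H, hs, hH⟩, hJ, hI, hGo⟩ := hs
  refine .block rfl rfl le_rfl ?_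
  cases o with
  | none =>
    obtain rfl := getElem?_options_eq_none.1 ho
    simpa [AtNode, Prog.eval, Prog.testOption, hs.zero, hJ, hI, hGo] using ⟨C, H, hs, hH⟩
  | some x =>
    obtain ⟨hi, hmem, hx⟩ := hs.load_option hj ho
    by_cases hxT : x ∈ T <;>
      simpa [AtNode, Prog.eval, Prog.testOption, hs.zero, hI, hJ, hGo, hi, hs.load_address hj, hmem,
        hs.load_current hx, hxT] using ⟨C, H, hs, hH⟩

theorem HaltsWith.addOption (hs : AtNode L j T i h s) (hj : j < L.m)
    (ho : (options (L.clause j))[i]? = some o) :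
    HaltsWith .addOption s 5 [] (AtNode L j (extend T o) i h) := by
  obtain ⟨⟨C, H, hs, hH⟩, hJ, hI, hGo⟩ := hs
  refine .block rfl rfl le_rfl ?_
  cases o with
  | none =>
    obtain rfl := getElem?_options_eq_none.1 ho
    simpa [AtNode, Prog.eval, Prog.addOption, Prog.setOption, Prog.nop, hs.zero, hJ, hI, hGo,
      extend] using ⟨C, H, hs, hH⟩
  | some x =>
    obtain ⟨hi, hmem, hx⟩ := hs.load_option hj ho
    have hs' := (((hs.setReg (r := rV) (v := 1) (by decide)).setReg (r := rP) (v := L.addr j)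
      (by decide)).setReg (r := rX) (v := x) (by decide)).insert_current hx (a := s.reg rT + x)
        (by simp [hs.baseT])
    simpa [AtNode, Prog.eval, Prog.addOption, Prog.setOption, hs.zero, hI, hJ, hGo, hi,
      hs.load_address hj, hmem, extend] using ⟨C, H, hs', hH⟩

theorem HaltsWith.undo (hs : AtNode L j (extend T o) i h s) (hj : j < L.m)
    (ho : (options (L.clause j))[i]? = some o) (hoT : ∀ x ∈ o, x ∉ T) :
    HaltsWith .undo s 5 [] (AtNode L j T (i + 1) h) := by
  obtain ⟨⟨C, H, hs, hH⟩, hJ, hI, hGo⟩ := hs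
  refine .block rfl rfl le_rfl ?_
  cases o with
  | none =>
    obtain rfl := getElem?_options_eq_none.1 ho
    simpa [AtNode, Prog.eval, Prog.undo, Prog.setOption, Prog.nop, hs.zero, hJ, hI, hGo] using
      ⟨C, H, hs, hH⟩
  | some x =>
    obtain ⟨hi, hmem, hx⟩ := hs.load_option hj ho
    have herase : (extend T (some x)).erase x = T := Finset.erase_insert (hoT x rfl)
    have hs' := ((hs.setReg (r := rP) (v := L.addr j) (by decide)).setReg (r := rX) (v := x)
      (by decide)).erase_current hx (a := s.reg rT + x) (by simp [hs.baseT])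
    simpa [AtNode, Prog.eval, Prog.undo, Prog.setOption, hs.zero, hI, hJ, hGo, hi,
      hs.load_address hj, hmem] using ⟨C, H, herase ▸ hs', hH⟩

theorem HaltsWith.checkNode (hs : AtNode L j T i h s) (hj : j < L.m) :
    HaltsWith .check s ((j + 1) * (L.n * 8 + 12) + 9 * L.n + 9) [] fun s' =>
      AtNode L j T i h s' ∧ (0 < s'.reg rOk ↔ Minimal (MeetsFirst L.clause (j + 1)) T) := by
  obtain ⟨⟨C, H, hs, hH⟩, hJ, hI, hGo⟩ := hs
  exact (HaltsWith.check hs hJ hj).frame.mono le_rfl fun s' ⟨⟨⟨C', hs'⟩, hOk⟩, hframe⟩ =>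
    ⟨⟨⟨C', H, hs', hH⟩, (hframe rJ rfl).trans hJ, (hframe rI rfl).trans hI,
      (hframe rGo rfl).trans hGo⟩, hOk⟩

theorem HaltsWith.descend (hs : AtNode L j T i h s) :
    HaltsWith .descend s 3 []
      (AtNode L (j + 1) T 0 (Function.update h j i)) := by
  obtain ⟨⟨C, H, hs, hH⟩, hJ, hI, hGo⟩ := hs
  refine .block rfl rfl le_rfl ⟨⟨C, _, ((hs.store_stack (y := j) ?_).setReg (by decide)).setReg
    (by decide), fun k hk => ?_⟩, ?_⟩
  · simp [hs.baseH, hJ]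
  · obtain rfl | hkj := eq_or_ne k j
    · simp [hI]
    · simpa [hkj] using hH k (by omega)
  · simpa [Prog.eval, Prog.descend, hJ] using hGo

theorem HaltsWith.attempt (hs : AtNode L j T i h s) (hj : j < L.m)
    (ho : (options (L.clause j))[i]? = some o) :
    HaltsWith .attempt s ((j + 1) * (L.n * 8 + 12) + 9 * L.n + 25) [] fun s' =>
      (Admissible (MeetsFirst L.clause j) (L.clause j) T o →
        AtNode L (j + 1) (extend T o) 0 (Function.update h j i) s') ∧
      (¬ Admissible (MeetsFirst L.clause j) (L.clause j) T o → AtNode L j T (i + 1) h s') := by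
  rw [Admissible, ← meetsFirst_succ]
  refine ((HaltsWith.testOption hs hj ho).seq fun s₁ ⟨hs₁, hV⟩ _ =>
    .ite (T := 5 + ((j + 1) * (L.n * 8 + 12) + 9 * L.n + 9 + (5 + 1))) (fun hlt => ?_)
      fun hlt => ?_).mono (by omega) fun _ => id
  · rw [hs₁.zero] at hlt
    obtain ⟨x, hxo, hxT⟩ := hV.1 hlt
    refine .block rfl rfl (by simp only [Prog.cost]; omega)
      ⟨fun hadm => absurd hxT (hadm.1 x hxo), fun _ => ?_⟩
    obtain ⟨⟨C, H, hs₁, hH⟩, hJ, hI, hGo⟩ := hs₁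
    simpa [AtNode, Prog.eval, hJ, hI, hGo] using ⟨C, H, hs₁, hH⟩
  rw [hs₁.zero] at hlt
  have hoT (x) (hxo : x ∈ o) (hxT : x ∈ T) : False := hlt (hV.2 ⟨x, hxo, hxT⟩)
  refine (HaltsWith.addOption hs₁ hj ho).seq fun s₂ hs₂ _ =>
    (HaltsWith.checkNode hs₂ hj).seq fun s₃ ⟨hs₃, hOk⟩ _ =>
    .ite (fun hlt => ?_) fun hlt => ?_
  · rw [hs₃.zero] at hlt
    have hadm := And.intro hoT (hOk.1 hlt)
    exact (HaltsWith.descend hs₃).mono (by decide) fun s' hs' =>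
      ⟨fun _ => hs', fun hnot => absurd hadm hnot⟩
  · rw [hs₃.zero] at hlt
    exact (HaltsWith.undo hs₃ hj ho hoT).mono le_rfl fun s' hs' =>
      ⟨fun hadm => absurd (hOk.2 hadm.2) hlt, fun _ => hs'⟩

theorem HaltsWith.back (hs : AtNode L (j + 1) (extend T o) i' (Function.update h j i) s)
    (hj : j < L.m) (ho : (options (L.clause j))[i]? = some o) (hoT : ∀ x ∈ o, x ∉ T) :
    HaltsWith .back s 8 [] (AtNode L j T (i + 1) h) := by
  obtain ⟨⟨C, H, hs, hH⟩, hJ, -, hGo⟩ := hs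
  refine .ite (T := 7) (fun _ => ?_) fun hlt => absurd hlt (by rw [hJ, hs.zero]; omega)
  refine .block_seq (p := .dec rJ) rfl rfl (.block_seq (p := .load rI rH rJ) rfl rfl
    (HaltsWith.undo ⟨⟨C, H, ?_, fun k hk => ?_⟩, ?_⟩ hj ho hoT))
  · simpa [Prog.eval] using hs
  · rw [hH k (by omega), Function.update_of_ne hk.ne]
  · simpa [Prog.eval, hJ, hGo, hs.load_stack hj] using hH j j.lt_succ_self

/-- A time bound for one step of the search. -/
def Layout.stepTime (L : Layout) : ℕ :=
  L.m * (L.n * 8 + 12) + 9 * L.n + 31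

theorem HaltsWith.searchStep_attempt (hs : AtNode L j T i h s) (hj : j < L.m)
    (ho : (options (L.clause j))[i]? = some o) :
    HaltsWith .searchStep s L.stepTime [] fun s' =>
      (Admissible (MeetsFirst L.clause j) (L.clause j) T o →
        AtNode L (j + 1) (extend T o) 0 (Function.update h j i) s') ∧
      (¬ Admissible (MeetsFirst L.clause j) (L.clause j) T o → AtNode L j T (i + 1) h s') := by
  have hi : i < (L.clause j).length + 1 := by
    simpa [options] using (List.getElem?_eq_some_iff.1 ho).1
  refine ((HaltsWith.readLength hs).seq fun s₁ ⟨hs₁, hLen⟩ _ => .ite (fun hlt => ?_) fun _ =>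
    .ite (fun _ => HaltsWith.attempt hs₁ hj ho) fun hlt => ?_).mono ?_ fun _ => id
  · rw [hLen, hs₁.2.2.1, Layout.candidates, if_pos hj] at hlt
    omega
  · rw [hs₁.2.1, hs₁.m] at hlt
    exact absurd hj hlt
  · have := Nat.mul_le_mul_right (L.n * 8 + 12) (Nat.succ_le_of_lt hj)
    rw [Layout.stepTime]
    rw [Nat.succ_eq_add_one] at this
    omega

theorem HaltsWith.searchStep_back
    (hs : AtNode L (j + 1) (extend T o) (L.candidates (j + 1) + 1) (Function.update h j i) s)
    (hj : j < L.m) (ho : (options (L.clause j))[i]? = some o) (hoT : ∀ x ∈ o, x ∉ T) :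
    HaltsWith .searchStep s L.stepTime [] (AtNode L j T (i + 1) h) := by
  refine ((HaltsWith.readLength hs).seq fun s₁ ⟨hs₁, hLen⟩ _ => .ite
    (fun _ => HaltsWith.back hs₁ hj ho hoT) fun hlt => ?_).mono
      (by rw [Layout.stepTime]; omega) fun _ => id
  rw [hLen, hs₁.2.2.1] at hlt
  omega

theorem HaltsWith.searchStep_stop (hs : AtNode L 0 T (L.candidates 0 + 1) h s) :
    HaltsWith .searchStep s L.stepTime [] fun s' => ¬ s'.reg rZ < s'.reg rGo := by
  refine ((HaltsWith.readLength hs).seq fun s₁ ⟨hs₁, hLen⟩ _ => .ite (T := 2) (fun _ => .ite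
    (fun hlt => ?_) fun _ => .block rfl rfl le_rfl ?_) fun hlt => ?_).mono
      (by rw [Layout.stepTime]; omega) fun _ => id
  · rw [hs₁.zero, hs₁.2.1] at hlt
    omega
  · simp [Prog.eval]
  · rw [hLen, hs₁.2.2.1] at hlt
    omega

/-- The list of the elements of `T` below `n`. -/
def elements (n : ℕ) (T : Finset ℕ) : List ℕ :=
  (List.range n).filter (· ∈ T)

theorem HaltsWith.writeSet (hs : Stores L s C T H) :
    HaltsWith .writeSet s (L.n * 5 + 2) (elements L.n T) (Stores L · C T H) := by
  have helements : elements L.n T =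
      (List.range L.n).flatMap fun y => if y ∈ T then [y] else [] := by
    rw [elements, ← List.filterMap_eq_filter, List.filterMap_eq_flatMap_toList]
    congr 1 with y
    by_cases hy : y ∈ T <;> simp [Option.guard, hy]
  rw [helements]
  refine .forTo_output (c := 3) (I := fun _ s => Stores L s C T H) (by decide) rfl rfl hs.n _
    (hs.setReg (by decide)) fun y hy s₁ hs₁ hE _ => ?_
  have hout := HaltsWith.block_output (p := .load rV rT rE ;; .ite rZ rV (.write rE) .nop) rfl s₁
  have hV := hs₁.load_current hy
  by_cases hyT : y ∈ T
  all_goals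
    simp only [Prog.output, Prog.eval, Prog.nop, State.reg_setReg, hs₁.zero, hE, hV, hyT,
      Nat.reduceEqDiff, OfNat.zero_ne_ofNat, if_true, if_false, lt_self_iff_false, zero_lt_one]
      at hout ⊢
    exact hout.mono (by decide) fun s' hs' => by simpa [hs'] using hs₁

theorem HaltsWithItem.searchStep (hs : AtNode L L.m T 0 h s) :
    HaltsWithItem .searchStep s L.stepTime (elements L.n T) (AtNode L L.m T 1 h) := by
  refine ((HaltsWith.readLength hs).seq_item (T' := L.n * 5 + 2 + 1 + 1 + 1) fun s₁ ⟨hs₁, _⟩ =>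
    .ite_false (by simp [hs₁.2.2.1]) (.ite_false (by simp [hs₁.2.1, hs₁.m]) ?_)).mono
      (by rw [Layout.stepTime]; omega) fun _ => id
  obtain ⟨⟨C, H, hs₁, hH⟩, hJ, hI, hGo⟩ := hs₁
  refine (HaltsWith.writeSet hs₁).endItem_seq (q := .inc rI) fun s₂ hs₂ hframe₂ =>
    .block rfl rfl (by simp only [Prog.cost]; omega) ⟨⟨C, H, hs₂.setReg (by decide), hH⟩, ?_⟩
  simpa [Prog.eval, hframe₂ rJ rfl, hframe₂ rI rfl, hframe₂ rGo rfl, hJ, hI] using hGo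

end Steps

/-! ### The search -/

section Traversal

variable {L : Layout} {h : ℕ → ℕ} {s : State} {T : Finset ℕ} {D G r j : ℕ} {ws : List (List ℕ)}

/-- A time bound for the search from the level `j` to the first leaf, or from the last leaf back to
the level `j`, where `r` levels are left. -/
def Layout.descentTime (L : Layout) : ℕ → ℕ → ℕ
  | 0, _ => L.stepTime + 1
  | r + 1, j => (L.stepTime + 1) * ((L.clause j).length + 1) + L.descentTime r (j + 1)

theorem Layout.descentTime_eq (L : Layout) (r j : ℕ) : L.descentTime r j =
    (L.stepTime + 1) * (∑ q ∈ Finset.range r, ((L.clause (j + q)).length + 1) + 1) := by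
  induction r generalizing j with
  | zero => simp [descentTime]
  | succ r ih =>
    rw [descentTime, ih, Finset.sum_range_succ', ← mul_add]
    simp only [add_zero, ← add_assoc, add_right_comm j]
    ring

/-- With the delay `D`, the search lists the leaves below each node of the level `j`, where `r`
levels are left. From there on, `ws` is what it lists after its return to the node, of which the
first item takes time `G`. -/
def Layout.ListsLeaves (L : Layout) (D r j : ℕ) : Prop :=
  ∀ ⦃T h G ws⦄, Minimal (MeetsFirst L.clause j) T →
    (∀ s, AtNode L j T (L.candidates j + 1) h s → Outputs (.loop rZ rGo .searchStep) D G s ws) →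
    G + L.descentTime r j ≤ D → ∀ s, AtNode L j T 0 h s →
      Outputs (.loop rZ rGo .searchStep) D (L.descentTime r j) s
        ((leaves L.clause r j T).map (elements L.n) ++ ws)

theorem Layout.listsLeaves_zero (L : Layout) (D : ℕ) : L.ListsLeaves D 0 L.m := by
  intro T h G ws _ hend hG s hs
  rw [descentTime] at hG
  refine .loop_item hs.zero_lt_go
    (HaltsWithItem.searchStep hs |>.mono le_rfl fun s' hs' => hend s' ?_) (by omega) le_rfl
  simpa [candidates] using hs'

open Classical in
theorem AtNode.outputs_children (hj : j < L.m) (hbelow : L.ListsLeaves D r (j + 1))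
    (hend : ∀ s, AtNode L j T (L.candidates j + 1) h s →
      Outputs (.loop rZ rGo .searchStep) D G s ws)
    (hG : G + L.descentTime (r + 1) j ≤ D) (hD : 2 * L.descentTime (r + 1) j ≤ D)
    (pre os : List (Option ℕ)) (hos : pre ++ os = options (L.clause j)) (s : State)
    (hs : AtNode L j T pre.length h s) :
    Outputs (.loop rZ rGo .searchStep) D ((L.stepTime + 1) * os.length +
        if children (MeetsFirst L.clause j) (L.clause j) T os = [] then G
        else L.descentTime r (j + 1)) s
      (((children (MeetsFirst L.clause j) (L.clause j) T os).flatMap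
        (leaves L.clause r (j + 1))).map (elements L.n) ++ ws) := by
  induction os generalizing pre s with
  | nil =>
    have hpre : pre.length = L.candidates j + 1 := by
      rw [← List.append_nil pre, hos, Layout.candidates, if_pos hj]
      simp [options]
    simpa [children] using hend s (hpre ▸ hs)
  | cons o os ih =>
    have ho : (options (L.clause j))[pre.length]? = some o := by simp [← hos]
    have hlen : os.length + 1 ≤ (L.clause j).length + 1 := by
      have := congrArg List.length hos
      simp only [List.length_append, List.length_cons, options, List.length_map] at this
      omega
    replace ih (s) (hs : AtNode L j T (pre.length + 1) h s) := ih (pre ++ [o]) (by simpa using hos)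
      s (by simpa using hs)
    have hstep := HaltsWith.searchStep_attempt hs hj ho
    have htime := Nat.mul_le_mul_left (L.stepTime + 1) hlen
    rw [Layout.descentTime] at hG hD
    rw [Nat.mul_succ] at htime
    rw [List.length_cons, Nat.mul_succ]
    by_cases hadm : Admissible (MeetsFirst L.clause j) (L.clause j) T o
    · rw [children_cons_of_admissible hadm, if_neg (List.cons_ne_nil _ _), List.flatMap_cons,
        List.map_append, List.append_assoc]
      refine .loop_step hs.zero_lt_go (hstep.mono le_rfl fun s₁ hs₁ => hbelow
        (meetsFirst_succ L.clause j ▸ hadm.2) (fun s₂ hs₂ => .loop_step hs₂.zero_lt_go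
          ((HaltsWith.searchStep_back hs₂ hj ho hadm.1).mono le_rfl ih) le_rfl) ?_ s₁ (hs₁.1 hadm))
        (by omega)
      split_ifs <;> omega
    · rw [children_cons_of_not_admissible hadm]
      exact .loop_step hs.zero_lt_go (hstep.mono le_rfl fun s₁ hs₁ => ih s₁ (hs₁.2 hadm)) (by omega)

theorem Layout.ListsLeaves.succ (hfresh : L.FreshFrom 0) (hj : j < L.m)
    (hD : 2 * L.descentTime (r + 1) j ≤ D) (hbelow : L.ListsLeaves D r (j + 1)) :
    L.ListsLeaves D (r + 1) j := by
  intro T h G ws hT hend hG s hs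
  obtain ⟨x, hx, hxq⟩ := hfresh j hj j.zero_le
  have hout := AtNode.outputs_children hj hbelow hend hG hD [] (options (L.clause j))
    (List.nil_append _) s hs
  rw [if_neg (children_ne_nil hx hxq hT)] at hout
  simpa [leaves, descentTime, options] using hout

theorem Layout.listsLeaves (hfresh : L.FreshFrom 0) (hj : j + r = L.m)
    (hD : 2 * L.descentTime r j ≤ D) : L.ListsLeaves D r j := by
  induction r generalizing j with
  | zero =>
    obtain rfl : j = L.m := hj
    exact L.listsLeaves_zero D
  | succ r ih =>
    have hbelow := ih (j := j + 1) (by omega) (by rw [descentTime] at hD; omega)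
    exact hbelow.succ hfresh (by omega) hD

theorem Outputs.search {C H : ℕ → ℕ} (hfresh : L.FreshFrom 0) (hs : Stores L s C ∅ H)
    (hD : 3 * L.descentTime L.m 0 ≤ D) :
    Outputs .search D (3 + L.descentTime L.m 0) s
      ((leaves L.clause L.m 0 ∅).map (elements L.n)) := by
  have hnode : AtNode L 0 ∅ 0 H ((Prog.set rJ 0 ;; .set rI 0 ;; .set rGo 1).eval s) := by
    simpa [AtNode, Prog.eval] using ⟨C, H, hs⟩
  have htime : L.stepTime + 1 ≤ L.descentTime L.m 0 := by
    rw [Layout.descentTime_eq]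
    exact Nat.le_mul_of_pos_right _ (by omega)
  refine (HaltsWith.block (Q := (· = _)) rfl rfl le_rfl rfl).seq_outputs fun s' hs' _ => ?_
  rw [← List.append_nil (List.map _ _)]
  refine Layout.listsLeaves hfresh (zero_add L.m) (by omega) (minimal_meetsFirst_zero.2 rfl)
    (fun s hs => .loop_step hs.zero_lt_go (HaltsWith.searchStep_stop hs |>.mono le_rfl
      fun _ => .loop_halt) (le_refl (1 + L.stepTime + 1))) (by omega) s' (hs' ▸ hnode)

end Traversal

/-! ### The input -/

section Input

variable {n : ℕ} {I : List (List (Fin n))} {φ : CNF n} {k : ℕ}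

/-- The variables of the `k`-th clause of the input. -/
def clauseVars (I : List (List (Fin n))) (k : ℕ) : List ℕ :=
  (I.getD k []).map Fin.val

/-- The address of the `k`-th clause of the input, and for `k = I.length` that of the free memory
behind the input. -/
def clauseAddr (I : List (List (Fin n))) (k : ℕ) : ℕ :=
  2 + ∑ q ∈ Finset.range k, ((clauseVars I q).length + 1)

theorem clauseAddr_zero : clauseAddr I 0 = 2 := by simp [clauseAddr]

theorem clauseAddr_succ : clauseAddr I (k + 1) = clauseAddr I k + (clauseVars I k).length + 1 := by
  rw [clauseAddr, Finset.sum_range_succ, ← add_assoc, ← add_assoc, clauseAddr]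

theorem clauseAddr_mono : Monotone (clauseAddr I) :=
  monotone_nat_of_le_succ fun k => by rw [clauseAddr_succ]; omega

theorem clauseAddr_add_length_lt {l : ℕ} (hkl : k < l) :
    clauseAddr I k + (clauseVars I k).length < clauseAddr I l := by
  have hle := clauseAddr_mono (I := I) (Nat.succ_le_of_lt hkl)
  rwa [Nat.succ_eq_add_one, clauseAddr_succ, Nat.succ_le_iff] at hle

-- On the left, the coercion elaborates to `l >>= fun x => pure ↑x`, followed by an identity map.
theorem map_coe_eq_map_val (l : List (Fin n)) : (l.map fun x => (x : ℕ)) = l.map Fin.val := by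
  simp [List.map_eq_flatMap]

theorem drop_encode (hk : k ≤ I.length) :
    (encode I).drop (clauseAddr I k) = (I.drop k).flatMap fun c => c.length :: c.map Fin.val := by
  induction k with
  | zero =>
    simp only [encode, map_coe_eq_map_val, clauseAddr_zero, List.drop_succ_cons, List.drop_zero]
  | succ k ih =>
    have hlen : (clauseVars I k).length = I[k].length := by
      rw [clauseVars, List.getD_eq_getElem _ _ hk, List.length_map]
    rw [clauseAddr_succ, add_assoc, ← List.drop_drop, ih (by omega), hlen,
      List.drop_eq_getElem_cons hk, List.flatMap_cons]
    exact List.drop_left' (by simp)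

theorem mem_initialState_clauseAddr {i x : ℕ} (hk : k < I.length)
    (hx : ((clauseVars I k).length :: clauseVars I k)[i]? = some x) :
    (initialState I).mem (clauseAddr I k + i) = x := by
  have hblock : (clauseVars I k).length :: clauseVars I k <+:
      (encode I).drop (clauseAddr I k) := by
    rw [drop_encode hk.le, List.drop_eq_getElem_cons hk, List.flatMap_cons, clauseVars,
      List.getD_eq_getElem _ _ hk, List.length_map]
    exact List.prefix_append _ _
  obtain ⟨hi, rfl⟩ := List.getElem?_eq_some_iff.1 hx
  change (encode I).getD _ 0 = _
  rw [List.getD_eq_getElem?_getD, ← List.getElem?_drop, List.prefix_iff_getElem?.1 hblock i hi,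
    Option.getD_some]

theorem mem_initialState_eq_zero {a : ℕ} (ha : clauseAddr I I.length ≤ a) :
    (initialState I).mem a = 0 := by
  have hnil : (encode I).drop (clauseAddr I I.length) = [] := by simp [drop_encode]
  exact List.getD_eq_default _ _ ((List.drop_eq_nil_iff.1 hnil).trans ha)

theorem IsListing.nodup_clauseVars (h : IsListing I φ) (hk : k < I.length) :
    (clauseVars I k).Nodup := by
  rw [clauseVars, List.getD_eq_getElem _ _ hk]
  exact (h.1 _ (List.getElem_mem _)).map Fin.val_injective

theorem lt_of_mem_clauseVars {x : ℕ} (hx : x ∈ clauseVars I k) : x < n := by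
  obtain ⟨y, -, rfl⟩ := List.mem_map.1 hx
  exact y.isLt

/-- The set of the variables of the `k`-th clause of the input. -/
def clauseSet (I : List (List (Fin n))) (k : ℕ) : Finset (Fin n) :=
  (I.getD k []).toFinset

theorem val_mem_clauseVars {x : Fin n} : (x : ℕ) ∈ clauseVars I k ↔ x ∈ clauseSet I k := by
  simp [clauseVars, clauseSet, Fin.val_inj]

theorem IsListing.image_clauseSet (h : IsListing I φ) :
    (Finset.range I.length).image (clauseSet I) = φ := by
  ext d
  simp only [← h.2.2, Finset.mem_image, Finset.mem_range, List.mem_toFinset, List.mem_iff_getElem,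
    List.length_map, List.getElem_map]
  constructor
  · rintro ⟨k, hk, rfl⟩
    exact ⟨k, hk, by rw [clauseSet, List.getD_eq_getElem _ _ hk]⟩
  · rintro ⟨k, hk, rfl⟩
    exact ⟨k, hk, by rw [clauseSet, List.getD_eq_getElem _ _ hk]⟩

theorem IsListing.injOn_clauseSet (h : IsListing I φ) :
    Set.InjOn (clauseSet I) (Finset.range I.length) := by
  intro k hk l hl hkl
  have hk : k < I.length := by simpa using hk
  have hl : l < I.length := by simpa using hl
  rw [clauseSet, clauseSet, List.getD_eq_getElem _ _ hk, List.getD_eq_getElem _ _ hl] at hkl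
  exact (h.2.1.getElem_inj_iff (hi := by simpa) (hj := by simpa)).1 (by simpa using hkl)

theorem IsListing.card_eq (h : IsListing I φ) : φ.card = I.length := by
  rw [← h.image_clauseSet, Finset.card_image_of_injOn h.injOn_clauseSet, Finset.card_range]

theorem IsListing.length_eq (h : IsListing I φ) :
    φ.length = ∑ k ∈ Finset.range I.length, (clauseVars I k).length := by
  rw [CNF.length, ← h.image_clauseSet, Finset.sum_image h.injOn_clauseSet]
  refine Finset.sum_congr rfl fun k hk => ?_
  rw [clauseSet, List.toFinset_card_of_nodup, clauseVars, List.length_map]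
  exact (h.nodup_clauseVars (Finset.mem_range.1 hk)).of_map

theorem IsListing.clauseAddr_length (h : IsListing I φ) :
    clauseAddr I I.length = 2 + (φ.length + φ.card) := by
  rw [clauseAddr, Finset.sum_add_distrib, ← h.length_eq, h.card_eq]
  simp

/-- The layout of an input with at most `n` clauses. -/
def IsListing.layout (h : IsListing I φ) (hn : φ.card ≤ n) : Layout where
  n := n
  m := I.length
  base := clauseAddr I I.length
  clause := clauseVars I
  addr := clauseAddr I
  m_le := h.card_eq ▸ hn
  lt_of_mem _ _ _ := lt_of_mem_clauseVars
  nodup _ := h.nodup_clauseVars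
  addr_lt _ := clauseAddr_add_length_lt

theorem IsListing.hasOwn (h : IsListing I φ) (hn : φ.card ≤ n) (hφ : φ.IsDegenerate 1)
    (h0 : ∀ c ∈ φ, c.Nonempty) : (h.layout hn).HasOwn := by
  intro S hS hlt
  change ∀ k ∈ S, k < I.length at hlt
  have hsub : S ⊆ Finset.range I.length := fun k hk => Finset.mem_range.2 (hlt k hk)
  have hψ : S.image (clauseSet I) ⊆ φ := h.image_clauseSet ▸ Finset.image_subset_image hsub
  obtain ⟨c, hc⟩ := hS.image (clauseSet I)
  obtain ⟨d, hd, x, hx, hone⟩ := hφ.exists_card_filter_le hψ hc (h0 c (hψ hc))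
  obtain ⟨k, hk, rfl⟩ := Finset.mem_image.1 hd
  refine ⟨k, hk, x, val_mem_clauseVars.2 hx, fun r hr hxr => ?_⟩
  refine h.injOn_clauseSet (hsub hr) (hsub hk) (Finset.card_le_one.1 hone _ ?_ _ ?_)
  · exact Finset.mem_filter.2 ⟨Finset.mem_image_of_mem _ hr, val_mem_clauseVars.1 hxr⟩
  · exact Finset.mem_filter.2 ⟨hd, hx⟩

end Input

/-! ### The phases before the search -/

section Phases

variable {n : ℕ} {I : List (List (Fin n))} {s : State}

theorem HaltsWith.advance {i l r : ℕ} (hil : l ≠ i) (hri : r ≠ i) (hrl : r ≠ l) :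
    HaltsWith (.forTo i l (.inc r)) s (3 * s.reg l + 2) [] fun s' =>
      s'.reg r = s.reg r + s.reg l ∧ s'.mem = s.mem := by
  refine (HaltsWith.forTo (c := 1) (I := fun k s' => s'.reg r = s.reg r + k ∧ s'.mem = s.mem) hil
    (by simpa using hri) (by simpa using hrl) rfl ?_ ?_).mono (by omega) fun _ => id
  · simp [hri]
  · rintro k - s' ⟨hreg, hmem⟩ - -
    refine .block rfl rfl le_rfl ?_
    simp [hri, hreg, hmem, add_assoc]

theorem HaltsWith.skipClause {k : ℕ} (hz : s.reg rZ = 0) (hp : s.reg rP = clauseAddr I k)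
    (hlen : s.mem (clauseAddr I k) = (clauseVars I k).length) :
    HaltsWith (.load rLen rP rZ ;; .inc rP ;; .forTo rE rLen (.inc rP)) s
      (3 * (clauseVars I k).length + 4) [] fun s' =>
        s'.reg rP = clauseAddr I (k + 1) ∧ s'.mem = s.mem := by
  refine (HaltsWith.block_seq rfl rfl <| .block_seq rfl rfl <|
    .advance (by decide) (by decide) (by decide)).mono ?_ ?_
  · simp only [Prog.cost, Prog.eval, hp, hz, add_zero, hlen, State.reg_setReg, Nat.reduceEqDiff,
      ↓reduceIte, Nat.succ_ne_self]
    omega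
  · rintro s' ⟨hreg, hmem⟩
    refine ⟨?_, by simpa using hmem⟩
    rw [clauseAddr_succ, add_right_comm]
    simpa [hz, hp, hlen] using hreg

theorem sum_clause_time_le (c K : ℕ) :
    ((List.range K).map fun k => c + (3 * (clauseVars I k).length + 4) + 2).sum + 3 ≤
      (c + 6) * clauseAddr I K := by
  induction K with
  | zero =>
    simp only [List.range_zero, List.map_nil, List.sum_nil, zero_add, clauseAddr_zero]
    omega
  | succ K ih =>
    have hle := Nat.mul_le_mul_right (clauseVars I K).length (show 3 ≤ c + 6 by omega)
    rw [List.range_succ, List.map_append, List.sum_append, List.map_singleton, List.sum_singleton,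
      clauseAddr_succ, Nat.mul_succ, Nat.mul_add]
    omega

theorem HaltsWith.walk {body : Prog} {J : ℕ → State → Prop} {c : ℕ} (hz : s.reg rZ = 0)
    (hm : s.reg rM = I.length) (hbody : ∀ r ∈ [rZ, rM, rP, rQ], body.changes r = false)
    (hJ : ∀ k s₁ s₂, J k s₁ → (∀ r, r < rP ∨ rE < r → s₂.reg r = s₁.reg r) → s₂.mem = s₁.mem →
      J k s₂)
    (hlen : ∀ k < I.length, ∀ s', J (k + 1) s' → s'.mem (clauseAddr I k) = (clauseVars I k).length)
    (hstart : J 0 s)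
    (hstep : ∀ k < I.length, ∀ s', J k s' → s'.reg rZ = 0 → s'.reg rP = clauseAddr I k →
      s'.reg rQ = k → HaltsWith body s' c [] (J (k + 1))) :
    HaltsWith (.walk body) s ((c + 6) * clauseAddr I I.length) [] fun s' =>
      J I.length s' ∧ s'.reg rP = clauseAddr I I.length := by
  simp only [List.forall_mem_cons] at hbody
  obtain ⟨hbZ, hbM, hbP, hbQ, -⟩ := hbody
  have hloop := HaltsWith.forTo_sum (s := s.setReg rP 2) (i := rQ) (l := rM) (K := I.length)
    (p := body ;; .load rLen rP rZ ;; .inc rP ;; .forTo rE rLen (.inc rP))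
    (I := fun k s' => J k s' ∧ s'.reg rP = clauseAddr I k ∧ s'.reg rZ = 0)
    (by decide) (by simpa using hbQ) (by simpa using hbM) (by simpa using hm)
    (fun k => c + (3 * (clauseVars I k).length + 4)) (fun _ => []) ?_ ?_
  · rw [List.flatMap_eq_nil_iff.2 fun _ _ => rfl] at hloop
    refine (HaltsWith.block_seq (p := .set rP 2) rfl rfl hloop).mono ?_ fun s' h => ⟨h.1, h.2.1⟩
    have := sum_clause_time_le (I := I) c I.length
    simp only [Prog.cost]
    omega
  · refine ⟨hJ 0 s _ hstart (fun r hr => ?_) rfl, by simp [clauseAddr_zero], by simpa using hz⟩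
    rw [State.reg_setReg, State.reg_setReg, if_neg (by omega), if_neg (by omega)]
  · rintro k hk s₁ ⟨hJ₁, hP, hZ⟩ hQ -
    refine (hstep k hk s₁ hJ₁ hZ hP hQ).seq fun s₂ hJ₂ hframe => ?_
    refine (HaltsWith.skipClause ((hframe _ hbZ).trans hZ) ((hframe _ hbP).trans hP)
      (hlen k hk s₂ hJ₂)).frame.mono le_rfl ?_
    rintro s₃ ⟨⟨hP₃, hmem⟩, hframe₃⟩
    refine ⟨hJ (k + 1) s₂ _ hJ₂ (fun r hr => ?_) hmem, by simpa using hP₃, ?_⟩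
    · rw [State.reg_setReg, if_neg (by omega)]
      exact hframe₃ r (by simp only [Prog.changes_forTo, Prog.changes, Bool.or_eq_false_iff,
        beq_eq_false_iff_ne]; omega)
    · simpa [hZ, hframe _ hbZ] using hframe₃ rZ rfl

theorem HaltsWith.skim (hz : s.reg rZ = 0) (hm : s.reg rM = I.length)
    (hs : s.mem = (initialState I).mem) :
    HaltsWith .skim s (9 * clauseAddr I I.length + 1) [] fun s' =>
      s'.mem = s.mem ∧ s'.reg rP = clauseAddr I I.length ∧
        s'.reg rOk = if ∃ k < I.length, clauseVars I k = [] then 0 else 1 := by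
  have hlen {k : ℕ} (hk : k < I.length) : s.mem (clauseAddr I k) = (clauseVars I k).length :=
    hs ▸ mem_initialState_clauseAddr (i := 0) hk rfl
  refine (HaltsWith.block_seq rfl rfl (HaltsWith.walk (c := 3) (I := I)
    (J := fun k s' => s'.mem = s.mem ∧
      s'.reg rOk = if ∃ q < k, clauseVars I q = [] then 0 else 1)
    (by simpa using hz) (by simpa using hm) (by decide) ?_ ?_ ?_ ?_)).mono ?_ ?_
  · exact fun k s₁ s₂ ⟨hmem, hok⟩ hreg hmem' => ⟨hmem'.trans hmem, (hreg rOk (by decide)).trans hok⟩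
  · exact fun k hk s' hs' => hs'.1 ▸ hlen hk
  · simp
  · rintro k hk s' ⟨hmem, hok⟩ hZ hP -
    have hread : s'.mem (clauseAddr I k) = (clauseVars I k).length := hmem ▸ hlen hk
    refine .block rfl rfl le_rfl ?_
    by_cases hempty : clauseVars I k = []
    · have hex : ∃ q ≤ k, clauseVars I q = [] := ⟨k, le_rfl, hempty⟩
      simp [hZ, hP, hread, hempty, hmem, hex]
    · have hex : (∃ q ≤ k, clauseVars I q = []) ↔ ∃ q < k, clauseVars I q = [] := by
        simp [Nat.le_iff_lt_or_eq, or_and_right, exists_or, hempty]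
      simp [Prog.nop, hZ, hP, hread, List.length_pos_iff, hempty, hmem, hok, hex]
  · simp only [Prog.cost]
    omega
  · rintro s' ⟨⟨hmem, hok⟩, hP⟩
    exact ⟨hmem, hP, hok⟩

theorem HaltsWith.allocate {n : ℕ} (hn : s.reg rN = n) :
    HaltsWith .allocate s (9 * n + 10) [] fun s' => s'.mem = s.mem ∧ s'.reg rO = s.reg rP ∧
      s'.reg rC = s.reg rP + n ∧ s'.reg rT = s.reg rP + 2 * n ∧ s'.reg rH = s.reg rP + 3 * n := by
  have h (r : ℕ) (hr : r ≠ rE ∧ r ≠ rN) (s : State) (hn : s.reg rN = n) :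
      HaltsWith (.forTo rE rN (.inc r)) s (3 * n + 2) [] fun s' =>
        s'.reg r = s.reg r + n ∧ s'.mem = s.mem :=
    hn ▸ .advance (by decide) hr.1 hr.2
  refine (HaltsWith.block_seq rfl rfl <| .block_seq rfl rfl <|
    (h rC (by decide) _ (by simpa using hn)).seq fun s₁ hs₁ hf₁ => .block_seq rfl rfl <|
    (h rT (by decide) _ (by simp [hf₁, hn])).seq fun s₂ hs₂ hf₂ => .block_seq rfl rfl <|
    (h rH (by decide) _ (by simp [hf₁, hf₂, hn])).frame.mono le_rfl fun s' ⟨hs₃, hf₃⟩ => ?_).mono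
    (by simp only [Prog.cost]; omega) fun _ => id
  simp only [hs₃, hf₃, hs₂, hf₂, hs₁, hf₁, Prog.changes_forTo, Prog.changes, Prog.eval,
    State.reg_setReg, State.mem_setReg, Nat.reduceBEq, Nat.reduceEqDiff, Bool.or_self, ↓reduceIte,
    true_and]
  omega

theorem HaltsWith.index (hz : s.reg rZ = 0) (hm : s.reg rM = I.length)
    (ho : s.reg rO = clauseAddr I I.length) (hs : s.mem = (initialState I).mem) :
    HaltsWith .index s (7 * clauseAddr I I.length) [] fun s' =>
      (∀ k < I.length, s'.mem (clauseAddr I I.length + k) = clauseAddr I k) ∧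
      ∀ a, a < clauseAddr I I.length ∨ clauseAddr I I.length + I.length ≤ a →
        s'.mem a = s.mem a := by
  refine (HaltsWith.walk (c := 1) (I := I) (J := fun k s' => s'.reg rO = clauseAddr I I.length ∧
      (∀ q < k, s'.mem (clauseAddr I I.length + q) = clauseAddr I q) ∧
      ∀ a, a < clauseAddr I I.length ∨ clauseAddr I I.length + k ≤ a → s'.mem a = s.mem a)
    hz hm (by decide) ?_ ?_ ?_ ?_).mono le_rfl fun s' h => h.1.2
  · rintro k s₁ s₂ ⟨hO, hnew, hold⟩ hreg hmem
    exact ⟨(hreg rO (by decide)).trans hO, hmem ▸ hnew, hmem ▸ hold⟩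
  · rintro k hk s' ⟨-, -, hold⟩
    rw [hold _ (.inl ((Nat.le_add_right _ _).trans_lt (clauseAddr_add_length_lt hk))), hs]
    exact mem_initialState_clauseAddr (i := 0) hk rfl
  · exact ⟨ho, by simp, by simp⟩
  · rintro k - s' ⟨hO, hnew, hold⟩ - hP hQ
    refine .block rfl rfl le_rfl ⟨by simpa using hO, fun q hq => ?_, fun a ha => ?_⟩
    · simp only [Prog.eval, State.mem_setMem, hO, hP, hQ]
      grind
    · simp only [Prog.eval, State.mem_setMem, hO, hQ]
      rw [if_neg (by omega), hold a (by omega)]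

end Phases

/-! ### The output -/

section Transversals

variable {n : ℕ} {I : List (List (Fin n))} {φ : CNF n} {s : Finset (Fin n)} {T : Finset ℕ}

/-- The elements of `T` below `n`, as elements of `Fin n`. -/
def restrictFin (n : ℕ) (T : Finset ℕ) : Finset (Fin n) :=
  Finset.univ.filter fun x => (x : ℕ) ∈ T

theorem restrictFin_map_val (s : Finset (Fin n)) : restrictFin n (s.map Fin.valEmbedding) = s := by
  ext x
  simp [restrictFin, Fin.val_inj]

theorem map_val_restrictFin_subset (T : Finset ℕ) :
    (restrictFin n T).map Fin.valEmbedding ⊆ T := by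
  intro x hx
  obtain ⟨y, hy, rfl⟩ := Finset.mem_map.1 hx
  exact (Finset.mem_filter.1 hy).2

theorem meets_clauseVars_iff {k : ℕ} :
    Meets (clauseVars I k) T ↔ ∃ x ∈ clauseSet I k, x ∈ restrictFin n T := by
  simp [Meets, clauseVars, clauseSet, restrictFin]

theorem IsListing.meetsFirst_iff (h : IsListing I φ) :
    MeetsFirst (clauseVars I) I.length T ↔ φ.IsTransversal (restrictFin n T) := by
  simp only [MeetsFirst, CNF.IsTransversal, ← h.image_clauseSet, Finset.forall_mem_image,
    Finset.mem_range, meets_clauseVars_iff]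

theorem IsListing.map_val_restrictFin (h : IsListing I φ)
    (hT : Minimal (MeetsFirst (clauseVars I) I.length) T) :
    (restrictFin n T).map Fin.valEmbedding = T := by
  refine hT.eq_of_le (h.meetsFirst_iff.2 ?_) (map_val_restrictFin_subset T)
  rw [restrictFin_map_val]
  exact h.meetsFirst_iff.1 hT.prop

theorem IsListing.minimal_map_val_iff (h : IsListing I φ) :
    Minimal (MeetsFirst (clauseVars I) I.length) (s.map Fin.valEmbedding) ↔
      Minimal φ.IsTransversal s := by
  rw [Minimal, Minimal, h.meetsFirst_iff, restrictFin_map_val]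
  refine and_congr_right fun _ => ⟨fun hmin s' hs' hle => ?_, fun hmin T hT hle => ?_⟩
  · refine Finset.map_subset_map.1 (hmin ?_ (Finset.map_subset_map.2 hle))
    rwa [h.meetsFirst_iff, restrictFin_map_val]
  · refine subset_trans (Finset.map_subset_map.2 (hmin (h.meetsFirst_iff.1 hT) ?_))
      (map_val_restrictFin_subset T)
    rw [← Finset.map_subset_map (f := Fin.valEmbedding)]
    exact (map_val_restrictFin_subset T).trans hle

theorem represents_elements (T : Finset ℕ) :
    Represents (elements n T) (positive (restrictFin n T)) := by
  refine ⟨(List.finRange n).filter fun x => (x : ℕ) ∈ T, (List.nodup_finRange n).filter _, ?_, ?_⟩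
  · rw [map_coe_eq_map_val, elements, ← List.map_coe_finRange_eq_range, List.filter_map]
    rfl
  · congr 1
    ext x
    simp [restrictFin]

theorem IsListing.exists_represents (h : IsListing I φ) {Ts : List (Finset ℕ)} (hTs : Ts.Nodup)
    (hmem : ∀ T, T ∈ Ts ↔ Minimal (MeetsFirst (clauseVars I) I.length) T) :
    ∃ ts : List (Finset (Literal n)), List.Forall₂ Represents (Ts.map (elements n)) ts ∧
      ts.Nodup ∧ ∀ t, t ∈ ts ↔ ∃ s, Minimal φ.IsTransversal s ∧ positive s = t := by
  refine ⟨Ts.map fun T => positive (restrictFin n T), ?_, ?_, fun t => ?_⟩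
  · simpa using fun T _ => represents_elements T
  · refine hTs.map_on fun T hT T' hT' heq => ?_
    rw [← h.map_val_restrictFin ((hmem T).1 hT), positive_injective heq,
      h.map_val_restrictFin ((hmem T').1 hT')]
  · rw [List.mem_map]
    constructor
    · rintro ⟨T, hT, rfl⟩
      have hmin := (hmem T).1 hT
      rw [← h.map_val_restrictFin hmin, h.minimal_map_val_iff] at hmin
      exact ⟨_, hmin, rfl⟩
    · rintro ⟨s, hs, rfl⟩
      exact ⟨_, (hmem _).2 (h.minimal_map_val_iff.2 hs), by rw [restrictFin_map_val]⟩

end Transversals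

/-! ### Delay -/

section Delay

variable {n : ℕ} {I : List (List (Fin n))} {φ : CNF n} {p q : Prog} {s : State}
  {D F F' T a b : ℕ} {C H : ℕ → ℕ}

theorem image_range_perm {m : ℕ} {f : Equiv.Perm ℕ} (hf : ∀ k < m, f k < m) :
    (Finset.range m).image f = Finset.range m :=
  Finset.eq_of_subset_of_card_le
    (Finset.image_subset_iff.2 fun k hk => Finset.mem_range.2 (hf k (Finset.mem_range.1 hk)))
    (Finset.card_image_of_injective _ f.injective).ge

theorem meetsFirst_comp_perm {c : ℕ → List ℕ} {m : ℕ} {f : Equiv.Perm ℕ} (hf : ∀ k < m, f k < m) :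
    MeetsFirst (fun k => c (f k)) m = MeetsFirst c m := by
  funext T
  simpa only [Finset.forall_mem_image, Finset.mem_range, MeetsFirst] using
    congrArg (fun S => ∀ k ∈ S, Meets (c k) T) (image_range_perm hf)

theorem CNF.card_erase_empty_le_length (φ : CNF n) : (φ.erase ∅).card ≤ φ.length := by
  rw [Finset.card_eq_sum_ones]
  refine (Finset.sum_le_sum fun c hc => ?_).trans
    (Finset.sum_le_sum_of_subset (Finset.erase_subset ∅ φ))
  exact Finset.card_pos.2 (Finset.nonempty_iff_ne_empty.2 (Finset.ne_of_mem_erase hc))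

theorem CNF.card_le_length_add_one (φ : CNF n) : φ.card ≤ φ.length + 1 :=
  (Nat.sub_le_iff_le_add.1 Finset.pred_card_le_card_erase).trans
    (Nat.add_le_add_right φ.card_erase_empty_le_length 1)

theorem CNF.length_le_length_mul_sq (φ : CNF n) : φ.length ≤ φ.length * n ^ 2 := by
  obtain rfl | hn := n.eq_zero_or_pos
  · simp [CNF.length, Finset.eq_empty_of_isEmpty]
  · exact Nat.le_mul_of_pos_right _ (Nat.pow_pos hn)

theorem IsListing.descentTime_permute (h : IsListing I φ) (hn : φ.card ≤ n) {f : Equiv.Perm ℕ}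
    (hf : ∀ k < I.length, f k < I.length) :
    ((h.layout hn).permute f hf).descentTime I.length 0 =
      ((h.layout hn).stepTime + 1) * (φ.length + φ.card + 1) := by
  rw [Layout.descentTime_eq]
  change ((h.layout hn).stepTime + 1) * (∑ q ∈ Finset.range I.length,
    ((clauseVars I (f (0 + q))).length + 1) + 1) = _
  simp only [zero_add]
  rw [← Finset.sum_image (f := fun k => (clauseVars I k).length + 1) f.injective.injOn,
    image_range_perm hf, Finset.sum_add_distrib, ← h.length_eq, h.card_eq]
  simp

theorem IsListing.stores (h : IsListing I φ) (hn : φ.card ≤ n)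
    (hZ : s.reg rZ = 0) (hN : s.reg rN = n) (hM : s.reg rM = I.length)
    (hO : s.reg rO = clauseAddr I I.length) (hC : s.reg rC = clauseAddr I I.length + n)
    (hT : s.reg rT = clauseAddr I I.length + 2 * n) (hH : s.reg rH = clauseAddr I I.length + 3 * n)
    (hnew : ∀ k < I.length, s.mem (clauseAddr I I.length + k) = clauseAddr I k)
    (hold : ∀ a, a < clauseAddr I I.length ∨ clauseAddr I I.length + I.length ≤ a →
      s.mem a = (initialState I).mem a) :
    Stores (h.layout hn) s 0 ∅ 0 := by
  have hm : I.length ≤ n := h.card_eq ▸ hn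
  have hfree {a : ℕ} (ha : clauseAddr I I.length + n ≤ a) : s.mem a = 0 := by
    rw [hold a (.inr (by omega)), mem_initialState_eq_zero (by omega)]
  refine ⟨hZ, hN, hM, hO, hC, hT, hH, fun k hk => ?_, fun k hk i x hx => ?_, hnew,
    fun y _ => hfree ?_, fun y _ => hfree ?_, fun k _ => hfree ?_, by simp⟩
  · rw [hold _ (.inl ((h.layout hn).addr_lt k hk |>.trans_le' (Nat.le_add_right _ _)))]
    exact mem_initialState_clauseAddr (i := 0) hk rfl
  · have hlt := (h.layout hn).addr_lt k hk
    have hi := (List.getElem?_eq_some_iff.1 hx).1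
    rw [hold _ (.inl (lt_of_le_of_lt (by omega) hlt))]
    exact mem_initialState_clauseAddr hk hx
  all_goals simp only [IsListing.layout]; omega

/-- Started in `s`, the program outputs the prime implicants of the function of `φ`, each of them
once. The first item is complete after at most `F` units of time, and the later delays are at most
`D`. -/
def OutputsPrimeImplicants (φ : CNF n) (p : Prog) (D F : ℕ) (s : State) : Prop :=
  ∃ (ws : List (List ℕ)) (ts : List (Finset (Literal n))), Outputs p D F s ws ∧
    List.Forall₂ Represents ws ts ∧ ts.Nodup ∧ ∀ t, t ∈ ts ↔ IsPrimeImplicant φ.fn t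

theorem HaltsWith.seq_outputsPrimeImplicants {P : State → Prop} (hp : HaltsWith p s T [] P)
    (hq : ∀ s', P s' → (∀ r, p.changes r = false → s'.reg r = s.reg r) →
      OutputsPrimeImplicants φ q D F s') (hF : T + F ≤ F') :
    OutputsPrimeImplicants φ (p ;; q) D F' s := by
  obtain ⟨u, s', hrun, hitem, hw, hlen, hP, hframe⟩ := hp.frame
  obtain ⟨ws, ts, ⟨u', s'', hrun', hout⟩, hts⟩ := hq s' hP hframe
  exact ⟨ws, ts, ⟨u ++ u', s'', hrun.seq hrun', hout.append hitem hw (by omega)⟩, hts⟩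

theorem OutputsPrimeImplicants.ite (hp : s.reg a < s.reg b → OutputsPrimeImplicants φ p D F s)
    (hq : ¬ s.reg a < s.reg b → OutputsPrimeImplicants φ q D F s) :
    OutputsPrimeImplicants φ (.ite a b p q) D (F + 1) s := by
  by_cases hab : s.reg a < s.reg b
  · obtain ⟨ws, ts, hout, hts⟩ := hp hab
    exact ⟨ws, ts, .ite (fun _ => hout) fun h => absurd hab h, hts⟩
  · obtain ⟨ws, ts, hout, hts⟩ := hq hab
    exact ⟨ws, ts, .ite (fun h => absurd h hab) fun _ => hout, hts⟩

theorem outputsPrimeImplicants_nop (h0 : ∅ ∈ φ) (hF : 1 ≤ F) :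
    OutputsPrimeImplicants φ .nop D F s := by
  refine ⟨[], [], HaltsWith.outputs (Q := fun _ => True) (.block rfl rfl hF trivial), .nil,
    List.nodup_nil, fun t => iff_of_false List.not_mem_nil fun ht => ?_⟩
  obtain ⟨T, hT, -⟩ := isPrimeImplicant_fn_iff.1 ht
  obtain ⟨x, hx, -⟩ := hT.prop ∅ h0
  exact Finset.notMem_empty x hx

theorem outputsPrimeImplicants_endItem (hF : 1 ≤ F) :
    OutputsPrimeImplicants (∅ : CNF n) .endItem D F s := by
  have hmin (T : Finset (Fin n)) : Minimal (CNF.IsTransversal ∅) T ↔ T = ∅ := by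
    rw [funext fun T => eq_true (show CNF.IsTransversal (∅ : CNF n) T by simp [CNF.IsTransversal])]
    simp
  refine ⟨[[]], [positive ∅], ⟨_, s, .endItem s, [], [], rfl, by simp, hF, rfl,
    .halt [] (by simp) rfl (by simp)⟩, .cons ⟨[], by simp, rfl, by simp⟩ .nil, by simp,
    fun t => ?_⟩
  simp [isPrimeImplicant_fn_iff, hmin, eq_comm]

theorem IsListing.outputsPrimeImplicants_search (h : IsListing I φ) {L : Layout}
    (hn : L.n = n) (hm : L.m = I.length) (hmeets : MeetsFirst L.clause I.length =
      MeetsFirst (clauseVars I) I.length) (hfresh : L.FreshFrom 0) (hs : Stores L s C ∅ H)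
    {d : ℕ} (hd : L.descentTime L.m 0 = d) (hD : 3 * d ≤ D) :
    OutputsPrimeImplicants φ .search D (3 + d) s := by
  subst hd
  obtain ⟨ts, hrep, hnodup, hmem⟩ := h.exists_represents (nodup_leaves L.nodup) fun T => by
    rw [mem_leaves L.nodup, hm, hmeets]
  exact ⟨_, ts, .search hfresh hs hD, hn ▸ hrep, hnodup,
    fun t => (hmem t).trans isPrimeImplicant_fn_iff.symm⟩

theorem IsListing.outputsPrimeImplicants_arrange (h : IsListing I φ) (hn : φ.card ≤ n)
    (hφ : φ.IsDegenerate 1) (h0 : ∀ c ∈ φ, c.Nonempty) (hs : Stores (h.layout hn) s C ∅ H)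
    (hD : 3 * (((h.layout hn).stepTime + 1) * (φ.length + φ.card + 1)) ≤ D) :
    OutputsPrimeImplicants φ (.arrange ;; .search) D
      (φ.card * (φ.card * (15 * n + 16) + 3 * n + 14) + 3 +
        (3 + ((h.layout hn).stepTime + 1) * (φ.length + φ.card + 1))) s := by
  refine (HaltsWith.arrange (h.hasOwn hn hφ h0) hs).seq_outputsPrimeImplicants
    (fun s' ⟨f, hf, C', hs', hfresh⟩ _ => h.outputsPrimeImplicants_search rfl rfl
      (meetsFirst_comp_perm (c := clauseVars I) hf) hfresh hs' (h.descentTime_permute hn hf) hD) ?_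
  rw [h.card_eq]
  exact le_rfl

theorem IsListing.exists_clauseVars_eq_nil_iff (h : IsListing I φ) :
    (∃ k < I.length, clauseVars I k = []) ↔ ∅ ∈ φ := by
  rw [← h.image_clauseSet]
  simp [clauseVars, clauseSet]

theorem arrangeTime_le {m n l : ℕ} (hmn : m ≤ n) (hml : m ≤ l) (hn : 1 ≤ n) :
    m * (m * (15 * n + 16) + 3 * n + 14) ≤ 48 * (l * n ^ 2) := by
  calc m * (m * (15 * n + 16) + 3 * n + 14)
    _ ≤ l * (n * (15 * n + 16 * n) + 3 * n * n + 14 * n * n) := by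
      gcongr
      · exact Nat.le_mul_of_pos_right _ hn
      · exact Nat.le_mul_of_pos_right _ hn
      · rw [mul_assoc]; exact Nat.le_mul_of_pos_right _ (Nat.mul_pos hn hn)
    _ = 48 * (l * n ^ 2) := by ring

theorem searchTime_le {m n l : ℕ} (hmn : m ≤ n) (hml : m ≤ l) (hn : 1 ≤ n) (hl : 1 ≤ l) :
    (m * (n * 8 + 12) + 9 * n + 31 + 1) * (l + m + 1) ≤ 183 * (l * n ^ 2) := by
  have hstep : m * (n * 8 + 12) + 9 * n + 31 + 1 ≤ 61 * n ^ 2 := by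
    calc m * (n * 8 + 12) + 9 * n + 31 + 1 ≤ n * (n * 8 + 12) + 9 * n + 31 + 1 := by gcongr
      _ ≤ 61 * n ^ 2 := by nlinarith
  calc (m * (n * 8 + 12) + 9 * n + 31 + 1) * (l + m + 1)
    _ ≤ 61 * n ^ 2 * (l + l + l) := by gcongr
    _ = 183 * (l * n ^ 2) := by ring

theorem IsListing.outputsPrimeImplicants_allocate (h : IsListing I φ) (hφ : φ.IsDegenerate 1)
    (h0 : ∅ ∉ φ) (hI : 0 < I.length) (hZ : s.reg rZ = 0) (hN : s.reg rN = n)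
    (hM : s.reg rM = I.length) (hP : s.reg rP = clauseAddr I I.length)
    (hmem : s.mem = (initialState I).mem) (hD : 549 * (φ.length * n ^ 2) ≤ D)
    (hF : 254 * (φ.length * n ^ 2) + 30 ≤ F) :
    OutputsPrimeImplicants φ (.allocate ;; .index ;; .arrange ;; .search) D F s := by
  have hne (c) (hc : c ∈ φ) : c.Nonempty := Finset.nonempty_iff_ne_empty.2 (h0 <| · ▸ hc)
  have hcard : φ.card ≤ n := by simpa using hφ.card_le hne
  have hcl : φ.card ≤ φ.length := by
    simpa [Finset.erase_eq_of_notMem h0] using φ.card_erase_empty_le_length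
  have hm := h.card_eq
  have hsearch := searchTime_le hcard hcl (by omega) (by omega)
  have harrange := arrangeTime_le hcard hcl (by omega)
  have haddr := h.clauseAddr_length
  have hl := φ.length_le_length_mul_sq
  have hnX : n ≤ φ.length * n ^ 2 := by nlinarith
  have hstep : (h.layout hcard).stepTime = φ.card * (n * 8 + 12) + 9 * n + 31 := hm ▸ rfl
  rw [← hstep] at hsearch
  refine (HaltsWith.allocate hN).seq_outputsPrimeImplicants (fun s₁ ⟨hmem₁, hO, hC, hT, hH⟩ hf₁ =>
    (HaltsWith.index ((hf₁ _ rfl).trans hZ) ((hf₁ _ rfl).trans hM) (hO.trans hP)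
      (hmem₁.trans hmem)).seq_outputsPrimeImplicants (fun s₂ ⟨hnew, hold⟩ hf₂ =>
        h.outputsPrimeImplicants_arrange hcard hφ hne (C := 0) (H := 0) ?_ ?_) le_rfl) ?_
  · refine h.stores hcard ?_ ?_ ?_ ?_ ?_ ?_ ?_ hnew fun a ha => ?_
    · rw [hf₂ _ rfl, hf₁ _ rfl, hZ]
    · rw [hf₂ _ rfl, hf₁ _ rfl, hN]
    · rw [hf₂ _ rfl, hf₁ _ rfl, hM]
    · rw [hf₂ _ rfl, hO, hP]
    · rw [hf₂ _ rfl, hC, hP]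
    · rw [hf₂ _ rfl, hT, hP]
    · rw [hf₂ _ rfl, hH, hP]
    · rw [hold a ha, hmem₁, hmem]
  · omega
  · omega

theorem IsListing.outputsPrimeImplicants_dualize (h : IsListing I φ) (hφ : φ.IsDegenerate 1) :
    OutputsPrimeImplicants φ .dualize (600 * (φ.length * n ^ 2 + 1))
      (600 * (φ.length * n ^ 2 + 1)) (initialState I) := by
  have hread : HaltsWith (.load rN rZ rZ ;; .set rV 1 ;; .load rM rZ rV) (initialState I) 3 []
      fun s => s.reg rZ = 0 ∧ s.reg rN = n ∧ s.reg rM = I.length ∧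
        s.mem = (initialState I).mem := by
    refine .block rfl rfl le_rfl ?_
    simp [Prog.eval, initialState, encode]
  refine hread.seq_outputsPrimeImplicants (F := 600 * (φ.length * n ^ 2) + 596 + 1)
    (fun s₁ ⟨hZ, hN, hM, hmem⟩ _ => .ite (fun hI => ?_) fun hI => ?_) (by omega)
  · have haddr := h.clauseAddr_length
    have hcard := φ.card_le_length_add_one
    have hl := φ.length_le_length_mul_sq
    refine (HaltsWith.skim hZ hM hmem).seq_outputsPrimeImplicants
      (F := 582 * (φ.length * n ^ 2) + 560 + 1)
      (fun s₂ ⟨hmem₂, hP, hok⟩ hf₂ => .ite (fun hlt => ?_) fun hlt => ?_) (by omega)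
    · refine h.outputsPrimeImplicants_allocate hφ (fun h0 => ?_) (by rwa [hZ, hM] at hI)
        ((hf₂ _ rfl).trans hZ) ((hf₂ _ rfl).trans hN) ((hf₂ _ rfl).trans hM) hP
        (hmem₂.trans hmem) (by omega) (by omega)
      rw [hok, if_pos (h.exists_clauseVars_eq_nil_iff.2 h0)] at hlt
      exact hlt.not_ge (Nat.zero_le _)
    · refine outputsPrimeImplicants_nop (by_contra fun h0 => hlt ?_) (by omega)
      rw [hok, if_neg (h.exists_clauseVars_eq_nil_iff.not.2 h0), hf₂ _ rfl, hZ]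
      exact one_pos
  · obtain rfl : φ = ∅ := Finset.card_eq_zero.1 (h.card_eq.trans (by omega))
    exact outputsPrimeImplicants_endItem (by omega)

theorem CNF.IsDegenerate.dualizesWithDelay (hφ : φ.IsDegenerate 1) :
    DualizesWithDelay .dualize φ (600 * (φ.length * n ^ 2 + 1)) := by
  intro I hI
  obtain ⟨ws, ts, ⟨u, s, hrun, hout⟩, hrep, hnodup, hmem⟩ := hI.outputsPrimeImplicants_dualize hφ
  exact ⟨u, s, ws, ts, hrun, hout.outputsWithDelay le_rfl, hrep, hnodup,
    fun t => (hmem t).trans isPrimeImplicate_dual_iff.symm, hmem⟩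

end Delay

end MonotoneDual

theorem mainTheorem10_general :
    (∃ (P : Prog) (C : ℕ), ∀ (n : ℕ) (φ : CNF n), φ.IsDegenerate 1 →
      DualizesWithDelay P φ (C * (φ.length * n ^ 2 + 1))) ∧
    (∀ (n : ℕ) (φ : CNF n), IsAntichain (· ⊆ ·) (φ : Set (Finset (Fin n))) → φ.AlphaAcyclic →
      φ.IsDegenerate 1) ∧
    (∀ (n : ℕ) (φ : CNF n) (a : List (GYOOp n)),
      IsAntichain (· ⊆ ·) (φ : Set (Finset (Fin n))) → GYO φ a {∅} →
      (∃ σ : Equiv.Perm (Fin n), ReversesRemovals σ a) ∧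
      ∀ σ : Equiv.Perm (Fin n), ReversesRemovals σ a → φ.IsDegenerateVia 1 σ) :=
  ⟨⟨.dualize, 600, fun _ _ hd => hd.dualizesWithDelay⟩, fun _ _ hφ ha => ha.isDegenerate hφ,
    fun _ _ _ hφ h => ⟨h.exists_reversesRemovals, fun _ hσ => h.isDegenerateVia hφ hσ⟩⟩

theorem mainTheorem10 :
    (∃ (P : Prog) (C : ℕ), ∀ (n : ℕ) (φ : CNF n), φ.IsPrime → φ.AlphaAcyclic →
      DualizesWithDelay P φ (C * (φ.length * n ^ 2 + 1))) ∧
    (∀ (n : ℕ) (φ : CNF n), φ.IsPrime → φ.AlphaAcyclic → φ.IsDegenerate 1) ∧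
    (∀ (n : ℕ) (φ : CNF n) (a : List (GYOOp n)), φ.IsPrime → GYO φ a {∅} →
      (∃ σ : Equiv.Perm (Fin n), ReversesRemovals σ a) ∧
      ∀ σ : Equiv.Perm (Fin n), ReversesRemovals σ a → φ.IsDegenerateVia 1 σ) :=
  have ⟨⟨P, C, hdual⟩, hdeg, hvia⟩ := mainTheorem10_general
  ⟨⟨P, C, fun n φ hp ha => hdual n φ (hdeg n φ hp.isAntichain ha)⟩,
    fun n φ hp => hdeg n φ hp.isAntichain, fun n φ a hp => hvia n φ a hp.isAntichain⟩
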